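/- Let $m=(m_0,m_1,\dots)$ be a bounded sequence of integers $m_k\ge 2$, let $G_m=\prod_{k\ge 0}\mathbb Z/m_k\mathbb Z$ be the corresponding (bounded) Vilenkin group with coordinatewise addition, and let $\mu$ be the normalized Haar measure on $G_m$ (the product of the uniform probability measures on the factors); $\mu$ also denotes the product measure on $G_m\times G_m$. Put $M_0=1$, $M_{k+1}=m_kM_k$, and let $I_n(x)=\{y\in G_m: y_i=x_i \text{ for } 0\le i<n\}$, $I_n=I_n(0)$; let $e_q\in G_m$ have $q$-th coordinate $1$ and all other coordinates $0$. Let $r_k(x)=\exp(2\pi i x_k/m_k)$, let $\psi_n=\prod_{k\ge0}r_k^{n_k}$ for $n=\sum_k n_kM_k$ with $0\le n_k<m_k$ (the Vilenkin system), and for $i,n\ge 0$ let \[ r_{i,n}(x,y)=\prod_{l=i}^{n}\Bigl(\sum_{s=0}^{m_l-1}\psi_{M_l}^{s}(x+y)\Bigr), \] an empty product being $1$. For $f\in L_1(G_m\times G_m)$, $(x,y)\in G_m\times G_m$ and $j\in\mathbb N$, write $\Delta(t,u)=|f(x-t,y-u)-f(x,y)|$ and set \[ \begin{aligned} W_j(x,y;f)={}&M_j^{-1}\sum_{q=0}^{j-1}\sum_{k=q}^{j-1}\sum_{a=1}^{m_q-1}M_qM_k^2\int_{I_k\times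 I_k(ae_q)}\Delta(t,u)\,r_{k+1,j-1}(t,u)\,d\mu(t,u)\\ &+M_j^{-1}\sum_{q=0}^{j-1}\sum_{k=q}^{j-1}\sum_{a=1}^{m_q-1}M_qM_k^2\int_{I_k(ae_q)\times I_k}\Delta(t,u)\,r_{k+1,j-1}(t,u)\,d\mu(t,u)\\ &+\sum_{s=0}^{j}\sum_{i=s}^{j}M_sM_i\sum_{a=1}^{m_s-1}\int_{I_j\times I_i(ae_s)}\Delta(t,u)\,d\mu(t,u)\\ &+\sum_{s=0}^{j}\sum_{i=s}^{j}M_sM_i\sum_{a=1}^{m_s-1}\int_{I_i(ae_s)\times I_j}\Delta(t,u)\,d\mu(t,u). \end{aligned} \] A point $(x,y)$ is called a Marcinkiewicz--Lebesgue point of $f$ if $\lim_{n\to\infty}W_n(x,y;f)=0$. Then for every $f\in L_1(G_m\times G_m)$ one has $\lim_{n\to\infty}W_n(x,y;f)=0$ for $\mu$-almost every $(x,y)\in G_m\times G_m$; thus almost every point of $G_m\times G_m$ is a Marcinkiewicz--Lebesgue point of $f$. -/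

import Mathlib

open MeasureTheory ProbabilityTheory Filter Topology

noncomputable section

namespace Vilenkin

/-- The Vilenkin group `G_m`, the complete direct product of the groups `Z_{m_k} = ℤ/m_kℤ`,
with coordinatewise addition (and the product topology and product σ-algebra). -/
abbrev G (m : ℕ → ℕ) : Type := (k : ℕ) → ZMod (m k)

/-- The normalized Haar measure on `G_m`: the direct product of the uniform probability
measures `μ_k({j}) = 1 / m_k` on `Z_{m_k}`. -/
def haar (m : ℕ → ℕ) : Measure (G m) :=
  Measure.infinitePi fun k => uniformOn (Set.univ : Set (ZMod (m k)))

/-- The normalized Haar measure on `G_m × G_m`. -/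
def haar2 (m : ℕ → ℕ) : Measure (G m × G m) := (haar m).prod (haar m)

/-- The basic neighbourhoods `I_n(x) = {y | y_0 = x_0, …, y_{n-1} = x_{n-1}}`. -/
def nbhd (m : ℕ → ℕ) (n : ℕ) (x : G m) : Set (G m) := {y | ∀ i < n, y i = x i}

/-- The element `a e_q` of `G_m`: its `q`-th coordinate is `a`, the others are `0`. -/
def axis (m : ℕ → ℕ) (q a : ℕ) : G m := Pi.single q (a : ZMod (m q))

/-- The generalized powers `M_0 = 1`, `M_{k+1} = m_k M_k`. -/
def M (m : ℕ → ℕ) : ℕ → ℕ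
  | 0 => 1
  | k + 1 => m k * M m k

/-- The digit `n_k` in the expansion `n = ∑ n_k M_k`, `0 ≤ n_k < m_k`. -/
def digit (m : ℕ → ℕ) (n k : ℕ) : ℕ := n / M m k % m k

/-- The generalized Rademacher functions `r_k(x) = exp (2 π i x_k / m_k)`. -/
def rademacher (m : ℕ → ℕ) (k : ℕ) (x : G m) : ℂ :=
  Complex.exp (2 * Real.pi * Complex.I * ((x k).val : ℂ) / (m k : ℂ))

/-- The Vilenkin functions `ψ_n = ∏_k r_k ^ n_k`. Only finitely many factors differ from `1`. -/
def psi (m : ℕ → ℕ) (n : ℕ) (x : G m) : ℂ :=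
  ∏ᶠ k : ℕ, rademacher m k x ^ digit m n k

/-- `r_{i,n}(x,y) = ∏_{l=i}^{n} ∑_{s=0}^{m_l-1} ψ_{M_l}(x+y)^s`; the empty product is `1`. -/
def rProd (m : ℕ → ℕ) (i n : ℕ) (x y : G m) : ℂ :=
  ∏ l ∈ Finset.Icc i n, ∑ s ∈ Finset.range (m l), psi m (M m l) (x + y) ^ s

/-- The quantity `W_j(x,y;f)`, with its four sums in the order `I_k × I_k(u_q e_q)`,
`I_k(t_q e_q) × I_k`, `I_j × I_i(u_s e_s)`, `I_i(t_s e_s) × I_j`. -/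
def W (m : ℕ → ℕ) (j : ℕ) (x y : G m) (f : G m × G m → ℂ) : ℂ :=
  (M m j : ℂ)⁻¹ * ∑ q ∈ Finset.range j, ∑ k ∈ Finset.Ico q j, ∑ a ∈ Finset.Ico 1 (m q),
      (M m q : ℂ) * (M m k : ℂ) ^ 2 *
        ∫ p in nbhd m k 0 ×ˢ nbhd m k (axis m q a),
          (‖f (x - p.1, y - p.2) - f (x, y)‖ : ℂ) * rProd m (k + 1) (j - 1) p.1 p.2 ∂(haar2 m)
  + (M m j : ℂ)⁻¹ * ∑ q ∈ Finset.range j, ∑ k ∈ Finset.Ico q j, ∑ a ∈ Finset.Ico 1 (m q),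
      (M m q : ℂ) * (M m k : ℂ) ^ 2 *
        ∫ p in nbhd m k (axis m q a) ×ˢ nbhd m k 0,
          (‖f (x - p.1, y - p.2) - f (x, y)‖ : ℂ) * rProd m (k + 1) (j - 1) p.1 p.2 ∂(haar2 m)
  + ∑ s ∈ Finset.range (j + 1), ∑ i ∈ Finset.Icc s j,
      (M m s : ℂ) * (M m i : ℂ) * ∑ a ∈ Finset.Ico 1 (m s),
        ∫ p in nbhd m j 0 ×ˢ nbhd m i (axis m s a),
          (‖f (x - p.1, y - p.2) - f (x, y)‖ : ℂ) ∂(haar2 m)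
  + ∑ s ∈ Finset.range (j + 1), ∑ i ∈ Finset.Icc s j,
      (M m s : ℂ) * (M m i : ℂ) * ∑ a ∈ Finset.Ico 1 (m s),
        ∫ p in nbhd m i (axis m s a) ×ˢ nbhd m j 0,
          (‖f (x - p.1, y - p.2) - f (x, y)‖ : ℂ) ∂(haar2 m)

/-- `(x, y)` is a Marcinkiewicz-Lebesgue point of `f` if `W_n(x,y;f) → 0`. -/
def IsMarcinkiewiczLebesguePoint (m : ℕ → ℕ) (f : G m × G m → ℂ) (z : G m × G m) : Prop :=
  Tendsto (fun n : ℕ => W m n z.1 z.2 f) atTop (𝓝 0)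

end Vilenkin

end

open scoped ENNReal

noncomputable section

set_option linter.unusedSectionVars false

namespace Vilenkin

/-! ### Weak type (1,1) for maximal operators of periodic kernels. -/

section MaximalKernel

variable {A : Type*} [AddCommGroup A] [MeasurableSpace A]

/-! Each of the four sums in `W` is at most an average of |f(z-p) - f(z)| against a nonnegative
kernel K_j, a sum of weighted indicators M_q M_k 1_S with S = S(q,k,a,j) and q ≤ k ≤ j. In the two
sums containing `rProd`, the product vanishes unless x_l + y_l = 0 for k < l < j, and its modulus is
at most M_j / M_{k+1}; so M_j⁻¹ absorbs it together with one factor M_k, and S is a thin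
antidiagonal set. In the other two sums S is a rectangle.

In all cases S lies in H_q = I_q × I_q, is H_j-periodic, shrinks as j grows and has measure O(1/(M_k
M_j)). Off H_n only the indices q < n survive, so the layer with second index k has mass
O(M_min(n,k) / M_j) there. The supremum over j ≥ n of this layer is dominated by its value at j =
max(n,k), and M_min(n,k) / M_max(n,k) ≤ 2^(-|n-k|) is summable in k. Hence sup_{j≥n} K_j has
integral O(1) off H_n, uniformly in n (`IsKernelFamily.isMaximalKernel`).

This tail bound gives weak type (1,1) by a Calderón–Zygmund stopping time along the cosets of H_n
(`IsMaximalKernel.lconv_le`): where the averages of g stay below t, periodicity replaces g by its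
average; a stopped coset is seen from outside only through the tail kernel. No cancellation is
needed. Approximation by continuous functions then gives convergence almost everywhere. -/

/-- Kernels whose maximal operator is of weak type `(1, 1)` and whose mass concentrates at the
origin, relative to a decreasing sequence `H` of subgroups. -/
structure IsMaximalKernel (μ : Measure A) (H : ℕ → AddSubgroup A) (K : ℕ → A → ℝ≥0∞)
    (C : ℝ≥0∞) : Prop where
  measurable : ∀ j, Measurable (K j)
  periodic : ∀ j, ∀ h ∈ H j, ∀ p, K j (p + h) = K j p
  mass : ∀ j, ∫⁻ p, K j p ∂μ ≤ C
  tail : ∀ n, ∫⁻ p in (H n : Set A)ᶜ, (⨆ j ≥ n, K j p) ∂μ ≤ C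
  concentrate : ∀ n, Tendsto (fun j => ∫⁻ p in (H n : Set A)ᶜ, K j p ∂μ) atTop (𝓝 0)

/-- The average of `g` over the coset `w + B`. -/
def cosetAvg (μ : Measure A) (B : AddSubgroup A) (g : A → ℝ≥0∞) (w : A) : ℝ≥0∞ :=
  (μ B)⁻¹ * ∫⁻ h in (B : Set A), g (w + h) ∂μ

variable [MeasurableAdd₂ A] [MeasurableNeg A] {μ : Measure A} [IsProbabilityMeasure μ]
  [μ.IsAddLeftInvariant]

lemma cosetAvg_add (B : AddSubgroup A) (hB : MeasurableSet (B : Set A)) (g : A → ℝ≥0∞) {h : A}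
    (hh : h ∈ B) (w : A) : cosetAvg μ B g (w + h) = cosetAvg μ B g w := by
  unfold cosetAvg
  congr 1
  rw [← lintegral_indicator hB, ← lintegral_indicator hB,
    ← lintegral_add_left_eq_self (fun x => (B : Set A).indicator (fun x => g (w + x)) x) h]
  congr 1
  ext x
  by_cases hx : x ∈ B
  · have : h + x ∈ B := B.add_mem hh hx
    simp [hx, this, add_assoc]
  · have : h + x ∉ B := fun h' => hx (by simpa using B.add_mem (B.neg_mem hh) h')
    simp [hx, this]

lemma measurable_cosetAvg (B : AddSubgroup A) {g : A → ℝ≥0∞}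
    (hg : Measurable g) : Measurable (cosetAvg μ B g) := by
  unfold cosetAvg
  refine Measurable.const_mul ?_ _
  exact Measurable.lintegral_prod_right' (f := fun p : A × A => g (p.1 + p.2))
    (hg.comp measurable_add)

/-- By Tonelli, averaging g over shifts by h in B can be done after integrating in w, and each shift
is undone by translation invariance because k does not see it. This is conditional expectation
tested against a B-periodic weight. -/
lemma lintegral_mul_cosetAvg (B : AddSubgroup A) (hB : MeasurableSet (B : Set A))
    (h0 : μ B ≠ 0) {k g : A → ℝ≥0∞} (hk : Measurable k) (hg : Measurable g)
    (hper : ∀ h ∈ B, ∀ p, k (p + h) = k p) :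
    ∫⁻ w, k w * cosetAvg μ B g w ∂μ = ∫⁻ w, k w * g w ∂μ := by
  have htop : μ B ≠ ∞ := measure_ne_top _ _
  have hm : Measurable fun p : A × A => g (p.1 + p.2) := hg.comp measurable_add
  have key : ∀ h ∈ (B : Set A), ∫⁻ w, k w * g (w + h) ∂μ = ∫⁻ w, k w * g w ∂μ := by
    intro h hh
    rw [← lintegral_add_right_eq_self (fun w => k w * g w) h]
    simp_rw [hper h hh]
  calc ∫⁻ w, k w * cosetAvg μ B g w ∂μ
      = ∫⁻ w, (μ B)⁻¹ * ∫⁻ h in (B : Set A), k w * g (w + h) ∂μ ∂μ := by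
        refine lintegral_congr fun w => ?_
        rw [lintegral_const_mul (k w) (f := fun h => g (w + h)) (hg.comp (measurable_const_add w)),
          cosetAvg]
        ring
    _ = (μ B)⁻¹ * ∫⁻ h in (B : Set A), ∫⁻ w, k w * g (w + h) ∂μ ∂μ := by
        have hm2 : Measurable fun p : A × A => k p.1 * g (p.1 + p.2) :=
          (hk.comp measurable_fst).mul hm
        rw [lintegral_const_mul _ hm2.lintegral_prod_right', lintegral_lintegral_swap]
        exact hm2.aemeasurable
    _ = (μ B)⁻¹ * ∫⁻ h in (B : Set A), ∫⁻ w, k w * g w ∂μ ∂μ := by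
        rw [setLIntegral_congr_fun hB key]
    _ = _ := by
        rw [setLIntegral_const, mul_comm _ (μ B), ← mul_assoc, ENNReal.inv_mul_cancel h0 htop,
          one_mul]

/-- Convolution of nonnegative functions. -/
def lconv (μ : Measure A) (k g : A → ℝ≥0∞) (z : A) : ℝ≥0∞ := ∫⁻ w, k (z - w) * g w ∂μ

/-- The points where `n` is the first index at which the average of `g` exceeds `t`. -/
def firstExceed (μ : Measure A) (H : ℕ → AddSubgroup A) (g : A → ℝ≥0∞) (t : ℝ≥0∞) (n : ℕ) :
    Set A :=
  {w | t < cosetAvg μ (H n) g w ∧ ∀ i < n, cosetAvg μ (H i) g w ≤ t}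

variable {H : ℕ → AddSubgroup A} {K : ℕ → A → ℝ≥0∞} {C : ℝ≥0∞}

/-- The stopping event at n involves only averages over cosets of H_i with i ≤ n, and these
subgroups all contain H_n. So stopped sets are unions of cosets of H_n. -/
lemma firstExceed_add (hH : Antitone H) (hHm : ∀ n, MeasurableSet (H n : Set A)) (g : A → ℝ≥0∞)
    (t : ℝ≥0∞) {n : ℕ} {h : A} (hh : h ∈ H n) (w : A) :
    w + h ∈ firstExceed μ H g t n ↔ w ∈ firstExceed μ H g t n := by
  unfold firstExceed
  simp only [Set.mem_ofPred_eq]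
  rw [cosetAvg_add _ (hHm n) g hh]
  refine and_congr_right fun _ => forall₂_congr fun i hi => ?_
  rw [cosetAvg_add _ (hHm i) g (hH hi.le hh)]

lemma measurableSet_firstExceed {g : A → ℝ≥0∞} (hg : Measurable g) (t : ℝ≥0∞) (n : ℕ) :
    MeasurableSet (firstExceed μ H g t n) := by
  have hm := fun i => measurable_cosetAvg (μ := μ) (H i) hg
  unfold firstExceed
  rw [Set.ofPred_and]
  refine (measurableSet_lt measurable_const (hm n)).inter ?_
  simp only [Set.ofPred_forall]
  exact MeasurableSet.iInter fun i => MeasurableSet.iInter fun _ =>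
    measurableSet_le (hm i) measurable_const

lemma disjoint_firstExceed (g : A → ℝ≥0∞) (t : ℝ≥0∞) :
    Pairwise (Function.onFun Disjoint (firstExceed μ H g t)) := by
  intro i j hij
  refine Set.disjoint_left.2 fun w hi hj => ?_
  rcases lt_or_gt_of_ne hij with h | h
  · exact absurd (hj.2 i h) (not_le.2 hi.1)
  · exact absurd (hi.2 j h) (not_le.2 hj.1)

lemma exists_firstExceed {g : A → ℝ≥0∞} {t : ℝ≥0∞} {w : A} {n : ℕ}
    (h : t < cosetAvg μ (H n) g w) : ∃ i ≤ n, w ∈ firstExceed μ H g t i := by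
  classical
  have hex : ∃ i, t < cosetAvg μ (H i) g w := ⟨n, h⟩
  exact ⟨Nat.find hex, Nat.find_min' hex h, Nat.find_spec hex,
    fun i hi => not_lt.1 (Nat.find_min hex hi)⟩

lemma tsum_lintegral_firstExceed_le {g : A → ℝ≥0∞} (hg : Measurable g) (t : ℝ≥0∞) :
    ∑' n, ∫⁻ w in firstExceed μ H g t n, g w ∂μ ≤ ∫⁻ w, g w ∂μ := by
  rw [← lintegral_iUnion (fun n => measurableSet_firstExceed hg t n) (disjoint_firstExceed g t)]
  exact setLIntegral_le_lintegral _ _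

/-- Doob's maximal inequality: on the n-th stopped set the average exceeds t, and since that set is
H_n-periodic the average integrates to the same value as g over it. -/
lemma mul_measure_iUnion_firstExceed_le (hH : Antitone H) (hHm : ∀ n, MeasurableSet (H n : Set A))
    (hH0 : ∀ n, μ (H n) ≠ 0) {g : A → ℝ≥0∞} (hg : Measurable g) (t : ℝ≥0∞) :
    t * μ (⋃ n, firstExceed μ H g t n) ≤ ∫⁻ w, g w ∂μ := by
  refine le_trans ?_ (tsum_lintegral_firstExceed_le (H := H) hg t)
  have hm := fun n => measurableSet_firstExceed (μ := μ) (H := H) hg t n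
  rw [measure_iUnion (disjoint_firstExceed g t) hm, ← ENNReal.tsum_mul_left]
  refine ENNReal.tsum_le_tsum fun n => ?_
  have h1 := lintegral_mul_cosetAvg (H n) (hHm n) (hH0 n) (g := g)
    (k := (firstExceed μ H g t n).indicator 1) (measurable_one.indicator (hm n)) hg
    (fun h hh p => by
      have := firstExceed_add (μ := μ) hH hHm g t hh p
      by_cases hp : p ∈ firstExceed μ H g t n <;> simp [hp, this])
  calc t * μ (firstExceed μ H g t n) = ∫⁻ w in firstExceed μ H g t n, t ∂μ := by
        rw [setLIntegral_const]
    _ ≤ ∫⁻ w in firstExceed μ H g t n, cosetAvg μ (H n) g w ∂μ :=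
        setLIntegral_mono (measurable_cosetAvg _ hg) fun w hw => hw.1.le
    _ = ∫⁻ w, (firstExceed μ H g t n).indicator 1 w * cosetAvg μ (H n) g w ∂μ := by
        rw [← lintegral_indicator (hm n)]
        congr 1; ext w
        by_cases hw : w ∈ firstExceed μ H g t n <;> simp [hw]
    _ = ∫⁻ w, (firstExceed μ H g t n).indicator 1 w * g w ∂μ := h1
    _ = _ := by
        rw [← lintegral_indicator (hm n)]
        congr 1; ext w
        by_cases hw : w ∈ firstExceed μ H g t n <;> simp [hw]

/-- The kernel dominating the contribution of `{w | n is the first exceeding index}` to the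
maximal operator. -/
def tailKernel (H : ℕ → AddSubgroup A) (K : ℕ → A → ℝ≥0∞) (n : ℕ) : A → ℝ≥0∞ :=
  (H n : Set A)ᶜ.indicator fun p => ⨆ j ≥ n, K j p

lemma measurable_tailKernel (hK : ∀ j, Measurable (K j)) (hHm : ∀ n, MeasurableSet (H n : Set A))
    (n : ℕ) : Measurable (tailKernel H K n) :=
  (Measurable.iSup fun j => Measurable.iSup fun _ => hK j).indicator (hHm n).compl

lemma measurable_conv_integrand {k g : A → ℝ≥0∞} (hk : Measurable k) (hg : Measurable g) :
    Measurable fun p : A × A => k (p.1 - p.2) * g p.2 :=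
  (hk.comp (by simp_rw [sub_eq_add_neg]; fun_prop)).mul (hg.comp measurable_snd)

lemma measurable_lconv {k g : A → ℝ≥0∞} (hk : Measurable k) (hg : Measurable g) :
    Measurable (lconv μ k g) :=
  (measurable_conv_integrand hk hg).lintegral_prod_right'

lemma lintegral_lconv {k g : A → ℝ≥0∞} (hk : Measurable k) (hg : Measurable g) :
    ∫⁻ z, lconv μ k g z ∂μ = (∫⁻ p, k p ∂μ) * ∫⁻ w, g w ∂μ := by
  unfold lconv
  rw [lintegral_lintegral_swap (measurable_conv_integrand hk hg).aemeasurable,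
    ← lintegral_const_mul _ hg]
  refine lintegral_congr fun w => ?_
  have : Measurable fun z => k (z - w) := hk.comp (by simp_rw [sub_eq_add_neg]; fun_prop)
  rw [lintegral_mul_const _ this, lintegral_sub_right_eq_self]

variable [μ.IsNegInvariant]

/-- Calderón–Zygmund splitting at a point z outside all stopped sets. Mass not stopped by time j
contributes at most C t; mass stopped at n ≤ j is paid for by the tail kernel of index n. -/
lemma IsMaximalKernel.lconv_le (hK : IsMaximalKernel μ H K C) (hH : Antitone H)
    (hHm : ∀ n, MeasurableSet (H n : Set A)) (hH0 : ∀ n, μ (H n) ≠ 0) {g : A → ℝ≥0∞}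
    (hg : Measurable g) (t : ℝ≥0∞) {z : A} (hz : z ∉ ⋃ n, firstExceed μ H g t n) (j : ℕ) :
    lconv μ (K j) g z ≤ C * t +
      ∑' n, lconv μ (tailKernel H K n) ((firstExceed μ H g t n).indicator g) z := by
  classical
  set S := firstExceed μ H g t with hS
  have hSm : ∀ n, MeasurableSet (S n) := fun n => measurableSet_firstExceed hg t n
  have hsub : Measurable fun w => z - w := by simp_rw [sub_eq_add_neg]; fun_prop
  -- The points not stopped up to time j; there the H_j-average is at most t.
  let B : Set A := ⋂ i ∈ Set.Iic j, (S i)ᶜ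
  have hBm : MeasurableSet B :=
    MeasurableSet.biInter (Set.to_countable _) fun i _ => (hSm i).compl
  have hBper : ∀ h ∈ H j, ∀ p, p + h ∈ B ↔ p ∈ B := by
    intro h hh p
    simp only [B, Set.mem_iInter, Set.mem_compl_iff, Set.mem_Iic]
    exact forall₂_congr fun i hi => not_congr (firstExceed_add hH hHm g t (hH hi hh) p)
  have hBle : ∀ w ∈ B, cosetAvg μ (H j) g w ≤ t := by
    intro w hw
    by_contra! hlt
    obtain ⟨i, hi, hwi⟩ := exists_firstExceed hlt
    simp only [B, Set.mem_iInter, Set.mem_compl_iff, Set.mem_Iic] at hw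
    exact hw i hi hwi
  have hpt : ∀ w, K j (z - w) * g w ≤ B.indicator (fun w => K j (z - w)) w * g w +
      ∑' n, tailKernel H K n (z - w) * (S n).indicator g w := by
    intro w
    by_cases hw : w ∈ B
    · simp only [Set.indicator_of_mem hw]
      exact le_self_add
    · have : ∃ i ≤ j, w ∈ S i := by
        simpa [B] using hw
      obtain ⟨i, hi, hwi⟩ := this
      -- Otherwise z would share the H_i-coset of w and be stopped at i as well.
      have hni : z - w ∉ H i := by
        intro h
        refine hz (Set.mem_iUnion.2 ⟨i, ?_⟩)
        have := (firstExceed_add (μ := μ) hH hHm g t h w).2 hwi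
        rwa [add_sub_cancel] at this
      refine le_trans ?_ (le_trans (ENNReal.le_tsum i) le_add_self)
      simp only [Set.indicator_of_mem hwi]
      gcongr
      rw [tailKernel, Set.indicator_of_mem (by simpa using hni)]
      exact le_iSup₂_of_le (f := fun j (_ : j ≥ i) => K j (z - w)) j hi le_rfl
  have hk : Measurable (B.indicator fun w => K j (z - w)) :=
    ((hK.measurable j).comp hsub).indicator hBm
  calc lconv μ (K j) g z
      ≤ ∫⁻ w, (B.indicator (fun w => K j (z - w)) w * g w +
        ∑' n, tailKernel H K n (z - w) * (S n).indicator g w) ∂μ := lintegral_mono hpt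
    _ = ∫⁻ w, B.indicator (fun w => K j (z - w)) w * g w ∂μ +
        ∑' n, lconv μ (tailKernel H K n) ((S n).indicator g) z := by
        rw [lintegral_add_left (f := fun w => B.indicator (fun w => K j (z - w)) w * g w)
          (hk.mul hg), lintegral_tsum]
        · rfl
        · intro n
          exact (((measurable_tailKernel hK.measurable hHm n).comp hsub).mul
            (hg.indicator (hSm n))).aemeasurable
    _ ≤ _ := by
        gcongr
        -- Both the indicator of B and K_j(z - ·) are H_j-periodic, so g may be replaced by its
        -- average, which is at most t on B.
        rw [← lintegral_mul_cosetAvg (H j) (hHm j) (hH0 j) hk hg]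
        · calc ∫⁻ w, B.indicator (fun w => K j (z - w)) w * cosetAvg μ (H j) g w ∂μ
              ≤ ∫⁻ w, K j (z - w) * t ∂μ := by
                refine lintegral_mono fun w => ?_
                by_cases hw : w ∈ B
                · simp only [Set.indicator_of_mem hw]
                  gcongr
                  exact hBle w hw
                · simp [hw]
            _ = (∫⁻ w, K j w ∂μ) * t := by
                rw [lintegral_mul_const t (f := fun w => K j (z - w)) ((hK.measurable j).comp hsub),
                  lintegral_sub_left_eq_self]
            _ ≤ C * t := by
                gcongr
                exact hK.mass j
        · intro h hh p
          have : K j (z - (p + h)) = K j (z - p) := by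
            rw [← hK.periodic j h hh (z - (p + h))]
            congr 1
            abel
          simp only [Set.indicator_apply, hBper h hh p, this]

/-- The maximal operator of the kernels is of weak type `(1, 1)`. -/
theorem IsMaximalKernel.measure_lt_iSup_lconv_le (hK : IsMaximalKernel μ H K C) (hH : Antitone H)
    (hHm : ∀ n, MeasurableSet (H n : Set A)) (hH0 : ∀ n, μ (H n) ≠ 0) (hC0 : C ≠ 0) (hC : C ≠ ∞)
    {g : A → ℝ≥0∞} (hg : Measurable g) {t : ℝ≥0∞} (ht : t ≠ 0) (ht' : t ≠ ∞) :
    μ {z | 2 * (C * t) < ⨆ j, lconv μ (K j) g z} ≤ 2 * (∫⁻ w, g w ∂μ) / t := by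
  set S := firstExceed μ H g t with hS
  have hSm : ∀ n, MeasurableSet (S n) := fun n => measurableSet_firstExceed hg t n
  set F : A → ℝ≥0∞ := fun z => ∑' n, lconv μ (tailKernel H K n) ((S n).indicator g) z with hF
  have hT := fun n => measurable_tailKernel hK.measurable hHm n
  have hFm : Measurable F :=
    Measurable.tsum fun n => measurable_lconv (hT n) (hg.indicator (hSm n))
  have hFint : ∫⁻ z, F z ∂μ ≤ C * ∫⁻ w, g w ∂μ := by
    rw [hF, lintegral_tsum fun n => (measurable_lconv (hT n) (hg.indicator (hSm n))).aemeasurable]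
    calc ∑' n, ∫⁻ z, lconv μ (tailKernel H K n) ((S n).indicator g) z ∂μ
        ≤ ∑' n, C * ∫⁻ w in S n, g w ∂μ := by
          refine ENNReal.tsum_le_tsum fun n => ?_
          rw [lintegral_lconv (hT n) (hg.indicator (hSm n)), lintegral_indicator (hSm n)]
          gcongr
          rw [tailKernel, lintegral_indicator (hHm n).compl]
          exact hK.tail n
      _ ≤ _ := by
          rw [ENNReal.tsum_mul_left]
          gcongr
          exact tsum_lintegral_firstExceed_le hg t
  have hCt0 : C * t ≠ 0 := mul_ne_zero hC0 ht
  have hCt : C * t ≠ ∞ := ENNReal.mul_ne_top hC ht'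
  -- One C t comes from the unstopped part; the other is the threshold at which Markov's inequality
  -- is applied to F.
  have hincl : {z | 2 * (C * t) < ⨆ j, lconv μ (K j) g z} ⊆ (⋃ n, S n) ∪ {z | C * t ≤ F z} := by
    intro z hz
    by_contra hcon
    simp only [Set.mem_union, not_or, Set.mem_ofPred_eq, not_le] at hcon
    refine absurd (Set.mem_ofPred.1 hz) (not_lt.2 (iSup_le fun j => ?_))
    refine (hK.lconv_le hH hHm hH0 hg t hcon.1 j).trans ?_
    rw [two_mul]
    gcongr
    exact hcon.2.le
  calc μ {z | 2 * (C * t) < ⨆ j, lconv μ (K j) g z}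
      ≤ μ (⋃ n, S n) + μ {z | C * t ≤ F z} := (measure_mono hincl).trans (measure_union_le _ _)
    _ ≤ (∫⁻ w, g w ∂μ) / t + (∫⁻ w, g w ∂μ) / t := by
        gcongr
        · rw [ENNReal.le_div_iff_mul_le (Or.inl ht) (Or.inl ht'), mul_comm]
          exact mul_measure_iUnion_firstExceed_le hH hHm hH0 hg t
        · refine (meas_ge_le_lintegral_div hFm.aemeasurable hCt0 hCt).trans ?_
          refine (ENNReal.div_le_div_right hFint _).trans ?_
          rw [ENNReal.mul_div_mul_left _ _ hC0 hC]
    _ = _ := by rw [two_mul, ENNReal.add_div]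

end MaximalKernel

/-! ### From the weak-type bound to convergence almost everywhere. -/

section AlmostEverywhere

variable {A : Type*} [AddCommGroup A] [MeasurableSpace A] [MeasurableAdd₂ A] [MeasurableNeg A]
  {μ : Measure A} [IsProbabilityMeasure μ] [μ.IsAddLeftInvariant] [μ.IsNegInvariant]
  {H : ℕ → AddSubgroup A} {K : ℕ → A → ℝ≥0∞} {C : ℝ≥0∞}

/-- The `K j`-weighted mean of `‖f (z - p) - f z‖`. -/
def oscMean (μ : Measure A) (K : ℕ → A → ℝ≥0∞) (f : A → ℂ) (j : ℕ) (z : A) : ℝ≥0∞ :=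
  ∫⁻ p, K j p * ‖f (z - p) - f z‖ₑ ∂μ

/-- Near the origin continuity makes the oscillation small against total mass C; away from it the
oscillation is at most 2D and the kernel mass vanishes by `concentrate`. -/
lemma IsMaximalKernel.tendsto_oscMean_of_continuous [TopologicalSpace A] [IsTopologicalAddGroup A]
    (hK : IsMaximalKernel μ H K C) (hHm : ∀ n, MeasurableSet (H n : Set A)) (hC : C ≠ ∞)
    (hbasis : ∀ U ∈ 𝓝 (0 : A), ∃ n, (H n : Set A) ⊆ U) {g : A → ℂ} (hg : Continuous g)
    {D : ℝ≥0∞} (hD : D ≠ ∞) (hgD : ∀ x, ‖g x‖ₑ ≤ D) (z : A) :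
    Tendsto (fun j => oscMean μ K g j z) atTop (𝓝 0) := by
  rw [ENNReal.tendsto_nhds_zero]
  intro ε hε
  have hδ : 0 < ε / 2 / C := ENNReal.div_pos (ENNReal.div_pos hε.ne' (by simp)).ne' hC
  have hU : {p | ‖g (z - p) - g z‖ₑ < ε / 2 / C} ∈ 𝓝 (0 : A) := by
    have hc : Continuous fun p => ‖g (z - p) - g z‖ₑ := by fun_prop
    exact hc.continuousAt.eventually_lt_const (by simpa using hδ)
  obtain ⟨N, hN⟩ := hbasis _ hU
  have ht : Tendsto (fun j => (2 * D) * ∫⁻ p in (H N : Set A)ᶜ, K j p ∂μ) atTop (𝓝 0) := by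
    simpa using ENNReal.Tendsto.const_mul (a := 2 * D) (hK.concentrate N)
      (Or.inr (ENNReal.mul_ne_top (by simp) hD))
  filter_upwards [(ENNReal.tendsto_nhds_zero.1 ht) (ε / 2) (ENNReal.div_pos hε.ne' (by simp))]
    with j hj
  rw [oscMean, ← lintegral_add_compl _ (hHm N)]
  have h1 : ∫⁻ p in (H N : Set A), K j p * ‖g (z - p) - g z‖ₑ ∂μ ≤ ε / 2 := by
    calc ∫⁻ p in (H N : Set A), K j p * ‖g (z - p) - g z‖ₑ ∂μ
        ≤ ∫⁻ p in (H N : Set A), K j p * (ε / 2 / C) ∂μ := by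
          refine setLIntegral_mono' (hHm N) fun p hp => ?_
          gcongr
          exact le_of_lt (hN hp)
      _ ≤ ∫⁻ p, K j p * (ε / 2 / C) ∂μ := setLIntegral_le_lintegral _ _
      _ = (∫⁻ p, K j p ∂μ) * (ε / 2 / C) := lintegral_mul_const _ (hK.measurable j)
      _ ≤ C * (ε / 2 / C) := by
          gcongr
          exact hK.mass j
      _ ≤ ε / 2 := ENNReal.mul_div_le
  have h2 : ∫⁻ p in (H N : Set A)ᶜ, K j p * ‖g (z - p) - g z‖ₑ ∂μ ≤ ε / 2 := by
    refine le_trans ?_ hj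
    rw [← lintegral_const_mul _ (hK.measurable j)]
    refine lintegral_mono fun p => ?_
    rw [mul_comm]
    gcongr
    refine enorm_sub_le.trans ?_
    rw [two_mul]
    exact add_le_add (hgD _) (hgD _)
  exact (add_le_add h1 h2).trans_eq (ENNReal.add_halves ε)

lemma IsMaximalKernel.oscMean_le_add (hK : IsMaximalKernel μ H K C) {f g : A → ℂ}
    (hf : Measurable f) (hg : Measurable g) (j : ℕ) (z : A) :
    oscMean μ K f j z ≤ oscMean μ K g j z + lconv μ (K j) (fun w => ‖f w - g w‖ₑ) z +
      C * ‖f z - g z‖ₑ := by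
  have hKj := hK.measurable j
  have hsub : Measurable fun w => z - w := by simp_rw [sub_eq_add_neg]; fun_prop
  have h1 : lconv μ (K j) (fun w => ‖f w - g w‖ₑ) z =
      ∫⁻ p, K j p * ‖f (z - p) - g (z - p)‖ₑ ∂μ := by
    rw [lconv, ← lintegral_sub_left_eq_self _ z]
    simp
  have hgz : Measurable fun p => K j p * ‖g (z - p) - g z‖ₑ :=
    hKj.mul ((hg.comp hsub).sub_const _).enorm
  have hfg : Measurable fun p => K j p * ‖f (z - p) - g (z - p)‖ₑ :=
    hKj.mul ((hf.comp hsub).sub (hg.comp hsub)).enorm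
  calc oscMean μ K f j z
      ≤ ∫⁻ p, (K j p * ‖g (z - p) - g z‖ₑ + K j p * ‖f (z - p) - g (z - p)‖ₑ +
          K j p * ‖f z - g z‖ₑ) ∂μ := by
        refine lintegral_mono fun p => ?_
        rw [← mul_add, ← mul_add]
        gcongr
        have : f (z - p) - f z =
            (g (z - p) - g z) + (f (z - p) - g (z - p)) + -(f z - g z) := by ring
        rw [this]
        refine (enorm_add_le _ _).trans ?_
        rw [enorm_neg]
        gcongr
        exact enorm_add_le _ _
    _ = oscMean μ K g j z + lconv μ (K j) (fun w => ‖f w - g w‖ₑ) z +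
          (∫⁻ p, K j p ∂μ) * ‖f z - g z‖ₑ := by
        rw [lintegral_add_left (hgz.fun_add hfg), lintegral_add_left hgz, h1,
          lintegral_mul_const _ hKj, oscMean]
    _ ≤ _ := by
        gcongr
        exact hK.mass j

/-- Almost every point is a Lebesgue point of an integrable function with respect to the
kernels `K j`. -/
theorem IsMaximalKernel.ae_tendsto_oscMean [TopologicalSpace A] [IsTopologicalAddGroup A]
    [BorelSpace A] [NormalSpace A] [μ.WeaklyRegular]
    (hK : IsMaximalKernel μ H K C) (hH : Antitone H) (hHm : ∀ n, MeasurableSet (H n : Set A))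
    (hH0 : ∀ n, μ (H n) ≠ 0) (hC0 : C ≠ 0) (hC : C ≠ ∞)
    (hbasis : ∀ U ∈ 𝓝 (0 : A), ∃ n, (H n : Set A) ⊆ U) {f : A → ℂ} (hf : Integrable f μ) :
    ∀ᵐ z ∂μ, Tendsto (fun j => oscMean μ K f j z) atTop (𝓝 0) := by
  wlog hfm : Measurable f generalizing f
  · obtain ⟨f', hf'm, hff'⟩ := hf.1.aemeasurable
    filter_upwards [this (hf.congr hff') hf'm, hff'] with z hz hzz
    refine hz.congr fun j => lintegral_congr_ae ?_
    filter_upwards [(quasiMeasurePreserving_sub_left μ z).ae hff'] with p hp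
    rw [hp, hzz]
  -- The factor 4 is 1 + 2 + 1: the continuous part, the maximal function of |f - g|, and the term C
  -- |f(z) - g(z)|.
  have key : ∀ t : ℝ≥0∞, t ≠ 0 → t ≠ ∞ →
      ∀ᵐ z ∂μ, ∀ᶠ j in atTop, oscMean μ K f j z ≤ 4 * (C * t) := by
    intro t ht ht'
    rw [ae_iff]
    refine le_antisymm (ENNReal.le_of_forall_pos_le_add fun ε hε _ => ?_) zero_le
    -- The exceptional set costs 2‖f - g‖₁/t by weak type plus ‖f - g‖₁/t by Markov, hence the
    -- third.
    have hη : (ε : ℝ≥0∞) * t / 3 ≠ 0 :=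
      (ENNReal.div_pos (mul_ne_zero (by simpa using hε.ne') ht) (by simp)).ne'
    obtain ⟨g, hg, -⟩ := hf.exists_boundedContinuous_lintegral_sub_le hη
    have hgm : Measurable g := g.continuous.measurable
    have hhm : Measurable fun w => ‖f w - g w‖ₑ := (hfm.sub hgm).enorm
    have hgt := fun z => hK.tendsto_oscMean_of_continuous hHm hC hbasis g.continuous
      (D := ‖g‖ₑ) (by simp) (fun x => by
        rw [← ofReal_norm, ← ofReal_norm]
        exact ENNReal.ofReal_le_ofReal (g.norm_coe_le_norm x)) z
    have hincl : {z | ¬ ∀ᶠ j in atTop, oscMean μ K f j z ≤ 4 * (C * t)} ⊆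
        {z | 2 * (C * t) < ⨆ j, lconv μ (K j) (fun w => ‖f w - g w‖ₑ) z} ∪
          {z | t ≤ ‖f z - g z‖ₑ} := by
      intro z hz
      by_contra hcon
      simp only [Set.mem_union, not_or, Set.mem_ofPred_eq, not_le, not_lt] at hcon
      refine (Set.mem_ofPred.1 hz) ?_
      filter_upwards [(ENNReal.tendsto_nhds_zero.1 (hgt z)) (C * t)
        (pos_iff_ne_zero.2 (mul_ne_zero hC0 ht))] with j hj
      calc oscMean μ K f j z ≤ C * t + 2 * (C * t) + C * t := by
            refine (hK.oscMean_le_add hfm hgm j z).trans ?_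
            gcongr
            · exact (le_iSup (fun j => lconv μ (K j) (fun w => ‖f w - g w‖ₑ) z) j).trans hcon.1
            · exact hcon.2.le
        _ = 4 * (C * t) := by ring
    have h3 : 2 * (∫⁻ w, ‖f w - g w‖ₑ ∂μ) / t + (∫⁻ w, ‖f w - g w‖ₑ ∂μ) / t ≤ ε := by
      rw [← ENNReal.add_div, ENNReal.div_le_iff ht ht']
      calc 2 * (∫⁻ w, ‖f w - g w‖ₑ ∂μ) + (∫⁻ w, ‖f w - g w‖ₑ ∂μ)
          = 3 * ∫⁻ w, ‖f w - g w‖ₑ ∂μ := by ring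
        _ ≤ 3 * (ε * t / 3) := by gcongr
        _ ≤ ε * t := ENNReal.mul_div_le
    calc μ {z | ¬ ∀ᶠ j in atTop, oscMean μ K f j z ≤ 4 * (C * t)}
        ≤ _ := (measure_mono hincl).trans (measure_union_le _ _)
      _ ≤ 2 * (∫⁻ w, ‖f w - g w‖ₑ ∂μ) / t + (∫⁻ w, ‖f w - g w‖ₑ ∂μ) / t :=
          add_le_add (hK.measure_lt_iSup_lconv_le hH hHm hH0 hC0 hC hhm ht ht')
            (meas_ge_le_lintegral_div hhm.aemeasurable ht ht')
      _ ≤ 0 + ε := by rw [zero_add]; exact h3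
  have hall : ∀ᵐ z ∂μ, ∀ n : ℕ, ∀ᶠ j in atTop, oscMean μ K f j z ≤ 4 * (C * (n + 1 : ℝ≥0∞)⁻¹) :=
    ae_all_iff.2 fun n => key _ (by simp) (by simp)
  filter_upwards [hall] with z hz
  rw [ENNReal.tendsto_nhds_zero]
  intro ε hε
  have hlim : Tendsto (fun n : ℕ => 4 * (C * (n + 1 : ℝ≥0∞)⁻¹)) atTop (𝓝 0) := by
    have h1 : Tendsto (fun n : ℕ => (n + 1 : ℝ≥0∞)⁻¹) atTop (𝓝 0) := by
      have := (tendsto_add_atTop_iff_nat 1).2 ENNReal.tendsto_inv_nat_nhds_zero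
      simpa using this
    have h2 := ENNReal.Tendsto.const_mul (a := 4 * C) h1
      (Or.inr (ENNReal.mul_ne_top (by simp) hC))
    simpa [mul_assoc] using h2
  obtain ⟨n, hn⟩ := ((ENNReal.tendsto_nhds_zero.1 hlim) ε hε).exists
  exact (hz n).mono fun j hj => hj.trans hn

end AlmostEverywhere

/-! ### Haar measure and the subgroups I_n × I_n. -/

section Group

variable {m : ℕ → ℕ}

instance finite_zmod [∀ k, NeZero (m k)] (k : ℕ) : Finite (ZMod (m k)) :=
  Finite.of_fintype (ZMod (m k))

instance [∀ k, NeZero (m k)] : BorelSpace (G m) := Pi.borelSpace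

instance [∀ k, NeZero (m k)] (k : ℕ) :
    IsProbabilityMeasure (uniformOn (Set.univ : Set (ZMod (m k)))) :=
  isProbabilityMeasure_uniformOn Set.finite_univ Set.univ_nonempty

lemma map_uniformOn_univ {n : ℕ} [NeZero n] (e : ZMod n ≃ ZMod n) :
    (uniformOn (Set.univ : Set (ZMod n))).map e = uniformOn Set.univ := by
  ext s hs
  rw [Measure.map_apply (measurable_of_finite _) hs, uniformOn_univ, uniformOn_univ,
    ← Equiv.image_symm_eq_preimage, Measure.count_injective_image e.symm.injective]

instance [∀ k, NeZero (m k)] : IsProbabilityMeasure (haar m) := by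
  unfold haar
  infer_instance

/-- Bijections preserve each uniform factor; translations and negation are both of this
coordinatewise form. -/
lemma map_haar [∀ k, NeZero (m k)] (e : ∀ k, ZMod (m k) ≃ ZMod (m k)) :
    (haar m).map (fun x k => e k (x k)) = haar m := by
  unfold haar
  rw [Measure.infinitePi_map_pi _ (fun k => measurable_of_finite (e k))]
  simp_rw [map_uniformOn_univ]

instance [∀ k, NeZero (m k)] : (haar m).IsAddLeftInvariant :=
  ⟨fun g => map_haar fun k => Equiv.addLeft (g k)⟩

instance [∀ k, NeZero (m k)] : (haar m).IsNegInvariant :=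
  ⟨map_haar fun _ => Equiv.neg _⟩

instance [∀ k, NeZero (m k)] : IsProbabilityMeasure (haar2 m) := by
  unfold haar2
  infer_instance

instance [∀ k, NeZero (m k)] : (haar2 m).IsAddLeftInvariant := by
  refine ⟨fun g => ?_⟩
  have h := Measure.map_prod_map (haar m) (haar m) (f := (g.1 + ·)) (g := (g.2 + ·))
    (measurable_const_add _) (measurable_const_add _)
  rw [map_add_left_eq_self, map_add_left_eq_self] at h
  exact h.symm

instance [∀ k, NeZero (m k)] : (haar2 m).IsNegInvariant := by
  refine ⟨?_⟩
  have h := Measure.map_prod_map (haar m) (haar m) (f := Neg.neg) (g := Neg.neg)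
    measurable_neg measurable_neg
  have h' : (haar m).map Neg.neg = haar m := Measure.map_neg_eq_self (haar m)
  rw [h'] at h
  exact h.symm

lemma M_pos (hm : ∀ k, 0 < m k) (k : ℕ) : 0 < M m k := by
  induction k with
  | zero => simp [M]
  | succ k ih => exact Nat.mul_pos (hm k) ih

lemma prod_range_eq_M (k : ℕ) : ∏ i ∈ Finset.range k, m i = M m k := by
  induction k with
  | zero => simp [M]
  | succ k ih => rw [Finset.prod_range_succ, ih, M, mul_comm]

lemma measurableSet_eqOn [∀ k, NeZero (m k)] (s : Finset ℕ) (c : G m) :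
    MeasurableSet {x : G m | ∀ i ∈ s, x i = c i} := by
  have : {x : G m | ∀ i ∈ s, x i = c i} = (s : Set ℕ).pi fun i => {c i} := by
    ext x; simp [Set.mem_pi]
  rw [this]
  exact MeasurableSet.pi s.countable_toSet fun i _ => MeasurableSet.singleton _

lemma haar_eqOn [∀ k, NeZero (m k)] (s : Finset ℕ) (c : G m) :
    haar m {x | ∀ i ∈ s, x i = c i} = ∏ i ∈ s, (m i : ℝ≥0∞)⁻¹ := by
  have : {x : G m | ∀ i ∈ s, x i = c i} = (s : Set ℕ).pi fun i => {c i} := by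
    ext x; simp [Set.mem_pi]
  rw [this, haar, Measure.infinitePi_pi _ fun i _ => MeasurableSet.singleton _]
  refine Finset.prod_congr rfl fun i _ => ?_
  rw [uniformOn_univ, Measure.count_singleton, ZMod.card, one_div]

lemma nbhd_eq (n : ℕ) (x : G m) : nbhd m n x = {y | ∀ i ∈ Finset.range n, y i = x i} := by
  ext y; simp [nbhd]

lemma measurableSet_nbhd [∀ k, NeZero (m k)] (n : ℕ) (x : G m) :
    MeasurableSet (nbhd m n x) := by
  rw [nbhd_eq]
  exact measurableSet_eqOn _ _

lemma haar_nbhd [∀ k, NeZero (m k)] (n : ℕ) (x : G m) :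
    haar m (nbhd m n x) = (M m n : ℝ≥0∞)⁻¹ := by
  rw [nbhd_eq, haar_eqOn, ← prod_range_eq_M, Nat.cast_prod,
    ENNReal.prod_inv_distrib]
  intro i _ j _ _
  exact Or.inr (ENNReal.natCast_ne_top _)

/-- The subgroup `I_n × I_n` of `G_m × G_m`. -/
def squareNbhd (m : ℕ → ℕ) (n : ℕ) : AddSubgroup (G m × G m) where
  carrier := nbhd m n 0 ×ˢ nbhd m n 0
  zero_mem' := by simp [nbhd]
  add_mem' := by
    rintro a b ⟨h1, h2⟩ ⟨h3, h4⟩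
    exact ⟨fun i hi => by simpa using congrArg₂ (· + ·) (h1 i hi) (h3 i hi),
      fun i hi => by simpa using congrArg₂ (· + ·) (h2 i hi) (h4 i hi)⟩
  neg_mem' := by
    rintro a ⟨h1, h2⟩
    exact ⟨fun i hi => by simpa using h1 i hi, fun i hi => by simpa using h2 i hi⟩

lemma mem_squareNbhd {n : ℕ} {p : G m × G m} :
    p ∈ squareNbhd m n ↔ ∀ i < n, p.1 i = 0 ∧ p.2 i = 0 := by
  change (∀ i < n, p.1 i = 0) ∧ (∀ i < n, p.2 i = 0) ↔ _
  exact ⟨fun h i hi => ⟨h.1 i hi, h.2 i hi⟩, fun h => ⟨fun i hi => (h i hi).1, fun i hi => (h i hi).2⟩⟩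

lemma antitone_squareNbhd : Antitone (squareNbhd m) := fun _ _ hab _ hp =>
  mem_squareNbhd.2 fun i hi => mem_squareNbhd.1 hp i (hi.trans_le hab)

lemma measurableSet_squareNbhd [∀ k, NeZero (m k)] (n : ℕ) :
    MeasurableSet (squareNbhd m n : Set (G m × G m)) :=
  (measurableSet_nbhd n 0).prod (measurableSet_nbhd n 0)

lemma haar2_squareNbhd_ne_zero [∀ k, NeZero (m k)] (n : ℕ) :
    haar2 m (squareNbhd m n) ≠ 0 := by
  have : haar2 m (squareNbhd m n) = haar m (nbhd m n 0) * haar m (nbhd m n 0) :=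
    Measure.prod_prod _ _
  rw [this, haar_nbhd]
  simp

lemma exists_nbhd_subset {U : Set (G m)} (hU : U ∈ 𝓝 (0 : G m)) : ∃ n, nbhd m n 0 ⊆ U := by
  rw [nhds_pi, Filter.mem_pi] at hU
  obtain ⟨I, hI, t, ht, hsub⟩ := hU
  obtain ⟨n, hn⟩ := hI.bddAbove
  refine ⟨n + 1, fun x hx => hsub fun i hi => ?_⟩
  rw [hx i (Nat.lt_succ_of_le (hn hi))]
  exact mem_of_mem_nhds (ht i)

lemma exists_squareNbhd_subset {U : Set (G m × G m)} (hU : U ∈ 𝓝 (0 : G m × G m)) :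
    ∃ n, (squareNbhd m n : Set (G m × G m)) ⊆ U := by
  rw [Prod.zero_eq_mk, mem_nhds_prod_iff] at hU
  obtain ⟨u, hu, v, hv, huv⟩ := hU
  obtain ⟨a, ha⟩ := exists_nbhd_subset hu
  obtain ⟨b, hb⟩ := exists_nbhd_subset hv
  refine ⟨max a b, fun p hp => huv ⟨ha fun i hi => ?_, hb fun i hi => ?_⟩⟩
  · exact (mem_squareNbhd.1 hp i (lt_max_of_lt_left hi)).1
  · exact (mem_squareNbhd.1 hp i (lt_max_of_lt_right hi)).2

end Group

/-! ### Set families whose kernels satisfy the maximal hypotheses. -/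

section KernelFamily

variable {m : ℕ → ℕ}

/-- Families of sets whose weighted indicator functions sum up to a maximal kernel. -/
structure IsKernelFamily (m : ℕ → ℕ) (S : ℕ → ℕ → ℕ → ℕ → Set (G m × G m)) (D : ℝ≥0∞) :
    Prop where
  measurable : ∀ q k a j, MeasurableSet (S q k a j)
  antitone : ∀ q k a, Antitone (S q k a)
  periodic : ∀ q k a j, q ≤ k → k ≤ j → ∀ h ∈ squareNbhd m j, ∀ p,
    p + h ∈ S q k a j ↔ p ∈ S q k a j
  subset : ∀ q k a j, q ≤ k → k ≤ j → S q k a j ⊆ (squareNbhd m q : Set (G m × G m))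
  measure_le : ∀ q k a j, q ≤ k → k ≤ j →
    haar2 m (S q k a j) ≤ D * (M m k : ℝ≥0∞)⁻¹ * (M m j : ℝ≥0∞)⁻¹

/-- The part of the kernel of a family with second index `k` and first index less than `n`. -/
def kernelPart (m : ℕ → ℕ) (S : ℕ → ℕ → ℕ → ℕ → Set (G m × G m)) (n k j : ℕ)
    (p : G m × G m) : ℝ≥0∞ :=
  ∑ q ∈ (Finset.range (k + 1)).filter (· < n), ∑ a ∈ Finset.Ico 1 (m q),
    (M m q : ℝ≥0∞) * (M m k : ℝ≥0∞) * (S q k a j).indicator 1 p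

/-- The kernel of a family of sets. -/
def familyKernel (m : ℕ → ℕ) (S : ℕ → ℕ → ℕ → ℕ → Set (G m × G m)) (j : ℕ)
    (p : G m × G m) : ℝ≥0∞ :=
  ∑ k ∈ Finset.range (j + 1), ∑ q ∈ Finset.range (k + 1), ∑ a ∈ Finset.Ico 1 (m q),
    (M m q : ℝ≥0∞) * (M m k : ℝ≥0∞) * (S q k a j).indicator 1 p

lemma monotone_M (hm : ∀ k, 2 ≤ m k) : Monotone (M m) :=
  monotone_nat_of_le_succ fun k => Nat.le_mul_of_pos_left _ (by have := hm k; omega)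

lemma sum_range_M_le (hm : ∀ k, 2 ≤ m k) (r : ℕ) :
    ∑ q ∈ Finset.range (r + 1), M m q ≤ 2 * M m r := by
  induction r with
  | zero => simp [M]
  | succ r ih =>
    rw [Finset.sum_range_succ]
    have : 2 * M m r ≤ M m (r + 1) := Nat.mul_le_mul_right _ (hm r)
    omega

lemma sum_filter_M_le (hm : ∀ k, 2 ≤ m k) (n k : ℕ) :
    ∑ q ∈ (Finset.range (k + 1)).filter (· < n), M m q ≤ 2 * M m (min n k) := by
  refine le_trans (Finset.sum_le_sum_of_subset ?_) (sum_range_M_le hm (min n k))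
  intro q hq
  simp only [Finset.mem_filter, Finset.mem_range] at hq ⊢
  omega

lemma two_pow_mul_M_le (hm : ∀ k, 2 ≤ m k) (r d : ℕ) : 2 ^ d * M m r ≤ M m (r + d) := by
  induction d with
  | zero => simp
  | succ d ih =>
    calc 2 ^ (d + 1) * M m r = 2 * (2 ^ d * M m r) := by ring
      _ ≤ m (r + d) * M m (r + d) := Nat.mul_le_mul (hm _) ih

lemma M_mul_inv_le (hm : ∀ k, 2 ≤ m k) {r s : ℕ} (hrs : r ≤ s) :
    (M m r : ℝ≥0∞) * (M m s : ℝ≥0∞)⁻¹ ≤ 2⁻¹ ^ (s - r) := by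
  have hpos : ∀ i, M m i ≠ 0 := fun i => (M_pos (fun k => by have := hm k; omega) i).ne'
  rw [← div_eq_mul_inv, ENNReal.div_le_iff (by simpa using hpos s) (ENNReal.natCast_ne_top _),
    ← ENNReal.inv_pow, mul_comm, ← div_eq_mul_inv,
    ENNReal.le_div_iff_mul_le (by simp) (by simp)]
  have := two_pow_mul_M_le hm r (s - r)
  rw [Nat.add_sub_cancel' hrs, mul_comm] at this
  exact_mod_cast this

lemma tsum_two_inv_pow_dist_le (n : ℕ) :
    ∑' k : ℕ, (2⁻¹ : ℝ≥0∞) ^ (max n k - min n k) ≤ 4 := by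
  have hgeo : ∑' k : ℕ, (2⁻¹ : ℝ≥0∞) ^ k = 2 := by
    rw [ENNReal.tsum_geometric, ENNReal.one_sub_inv_two, inv_inv]
  rw [← ENNReal.summable.sum_add_tsum_nat_add' (k := n)]
  have h1 : ∑ k ∈ Finset.range n, (2⁻¹ : ℝ≥0∞) ^ (max n k - min n k) ≤ 2 := by
    rw [← Finset.sum_range_reflect]
    refine le_trans (Finset.sum_le_sum (g := fun k => (2⁻¹ : ℝ≥0∞) ^ k) fun k hk => ?_)
      ((ENNReal.sum_le_tsum _).trans hgeo.le)
    refine pow_le_pow_right_of_le_one' (by simp) ?_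
    have := Finset.mem_range.1 hk
    omega
  have h2 : ∑' k : ℕ, (2⁻¹ : ℝ≥0∞) ^ (max n (k + n) - min n (k + n)) ≤ 2 := by
    refine le_trans (ENNReal.tsum_le_tsum fun k => ?_) hgeo.le
    refine pow_le_pow_right_of_le_one' (by simp) ?_
    omega
  calc _ ≤ (2 : ℝ≥0∞) + 2 := add_le_add h1 h2
    _ = 4 := by norm_num

variable [∀ k, NeZero (m k)] {S : ℕ → ℕ → ℕ → ℕ → Set (G m × G m)} {D : ℝ≥0∞}

lemma IsKernelFamily.measurable_kernelPart (hS : IsKernelFamily m S D) (n k j : ℕ) :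
    Measurable (kernelPart m S n k j) :=
  Finset.measurable_fun_sum _ fun _ _ => Finset.measurable_fun_sum _ fun _ _ =>
    (measurable_one.indicator (hS.measurable _ _ _ _)).const_mul _

lemma IsKernelFamily.measurable_familyKernel (hS : IsKernelFamily m S D) (j : ℕ) :
    Measurable (familyKernel m S j) :=
  Finset.measurable_fun_sum _ fun _ _ => Finset.measurable_fun_sum _ fun _ _ =>
    Finset.measurable_fun_sum _ fun _ _ =>
      (measurable_one.indicator (hS.measurable _ _ _ _)).const_mul _

/-- The weight M_k cancels the 1/M_k in `measure_le`, there are fewer than B values of a, and the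
M_q with q < n, q ≤ k sum geometrically to at most 2 M_min(n,k). -/
lemma IsKernelFamily.lintegral_kernelPart_le (hm : ∀ k, 2 ≤ m k) {B : ℕ} (hB : ∀ k, m k ≤ B)
    (hS : IsKernelFamily m S D) {n k j : ℕ} (hkj : k ≤ j) :
    ∫⁻ p, kernelPart m S n k j p ∂(haar2 m) ≤
      2 * (B * D) * ((M m (min n k) : ℝ≥0∞) * (M m j : ℝ≥0∞)⁻¹) := by
  have hpos : ∀ i, M m i ≠ 0 := fun i => (M_pos (fun k => by have := hm k; omega) i).ne'
  have hmeas : ∀ q a, Measurable fun p => (M m q : ℝ≥0∞) * (M m k : ℝ≥0∞) *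
      (S q k a j).indicator 1 p := fun q a =>
    (measurable_one.indicator (hS.measurable _ _ _ _)).const_mul _
  unfold kernelPart
  rw [lintegral_finsetSum _ fun q _ => Finset.measurable_fun_sum _ fun a _ => hmeas q a]
  calc ∑ q ∈ (Finset.range (k + 1)).filter (· < n), ∫⁻ p, ∑ a ∈ Finset.Ico 1 (m q),
        (M m q : ℝ≥0∞) * (M m k : ℝ≥0∞) * (S q k a j).indicator 1 p ∂(haar2 m)
      ≤ ∑ q ∈ (Finset.range (k + 1)).filter (· < n),
          (M m q : ℝ≥0∞) * (B * D * (M m j : ℝ≥0∞)⁻¹) := by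
        refine Finset.sum_le_sum fun q hq => ?_
        have hqk : q ≤ k := by
          simp only [Finset.mem_filter, Finset.mem_range] at hq
          omega
        rw [lintegral_finsetSum _ fun a _ => hmeas q a]
        calc ∑ a ∈ Finset.Ico 1 (m q), ∫⁻ p, (M m q : ℝ≥0∞) * (M m k : ℝ≥0∞) *
              (S q k a j).indicator 1 p ∂(haar2 m)
            ≤ ∑ a ∈ Finset.Ico 1 (m q), (M m q : ℝ≥0∞) * (D * (M m j : ℝ≥0∞)⁻¹) := by
              refine Finset.sum_le_sum fun a _ => ?_
              rw [lintegral_const_mul _ (measurable_one.indicator (hS.measurable _ _ _ _)),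
                lintegral_indicator_one (hS.measurable _ _ _ _), mul_assoc]
              gcongr (M m q : ℝ≥0∞) * ?_
              calc (M m k : ℝ≥0∞) * haar2 m (S q k a j)
                  ≤ (M m k : ℝ≥0∞) * (D * (M m k : ℝ≥0∞)⁻¹ * (M m j : ℝ≥0∞)⁻¹) := by
                    gcongr
                    exact hS.measure_le q k a j hqk hkj
                _ = ((M m k : ℝ≥0∞) * (M m k : ℝ≥0∞)⁻¹) * (D * (M m j : ℝ≥0∞)⁻¹) := by ring
                _ = D * (M m j : ℝ≥0∞)⁻¹ := by
                    rw [ENNReal.mul_inv_cancel (by simpa using hpos k)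
                      (ENNReal.natCast_ne_top _), one_mul]
          _ = ((m q - 1 : ℕ) : ℝ≥0∞) * ((M m q : ℝ≥0∞) * (D * (M m j : ℝ≥0∞)⁻¹)) := by
              rw [Finset.sum_const, Nat.card_Ico, nsmul_eq_mul]
          _ ≤ (B : ℝ≥0∞) * ((M m q : ℝ≥0∞) * (D * (M m j : ℝ≥0∞)⁻¹)) := by
              gcongr
              exact (Nat.sub_le _ _).trans (hB q)
          _ = _ := by ring
    _ = ((∑ q ∈ (Finset.range (k + 1)).filter (· < n), M m q : ℕ) : ℝ≥0∞) *
          (B * D * (M m j : ℝ≥0∞)⁻¹) := by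
        rw [← Finset.sum_mul, Nat.cast_sum]
    _ ≤ ((2 * M m (min n k) : ℕ) : ℝ≥0∞) * (B * D * (M m j : ℝ≥0∞)⁻¹) := by
        gcongr
        exact sum_filter_M_le hm n k
    _ = _ := by
        push_cast
        ring

/-- Sets with q ≥ n lie inside I_q × I_q, hence inside I_n × I_n, and miss p. -/
lemma IsKernelFamily.familyKernel_le (hS : IsKernelFamily m S D) {n j : ℕ} {p : G m × G m}
    (hp : p ∉ squareNbhd m n) :
    familyKernel m S j p ≤ ∑ k ∈ Finset.range (j + 1), kernelPart m S n k j p := by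
  refine Finset.sum_le_sum fun k hk => ?_
  rw [kernelPart, Finset.sum_filter]
  refine Finset.sum_le_sum fun q hq => ?_
  have hk := Finset.mem_range.1 hk
  have hq := Finset.mem_range.1 hq
  split_ifs with hqn
  · exact le_rfl
  · refine le_of_eq (Finset.sum_eq_zero fun a _ => ?_)
    have : p ∉ S q k a j := fun h => hp
      (antitone_squareNbhd (not_lt.1 hqn) (hS.subset q k a j (by omega) (by omega) h))
    simp [this]

lemma kernelPart_antitone (hS : IsKernelFamily m S D) (n k : ℕ) (p : G m × G m) :
    Antitone fun j => kernelPart m S n k j p := by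
  intro i j hij
  refine Finset.sum_le_sum fun q _ => Finset.sum_le_sum fun a _ => ?_
  gcongr
  exact hS.antitone q k a hij

lemma tendsto_succ_mul_two_inv_pow :
    Tendsto (fun j : ℕ => ((j + 1 : ℕ) : ℝ≥0∞) * 2⁻¹ ^ j) atTop (𝓝 0) := by
  have h1 : Tendsto (fun j : ℕ => ((j : ℝ) + 1) * (2⁻¹ : ℝ) ^ j) atTop (𝓝 0) := by
    have h2 := tendsto_self_mul_const_pow_of_lt_one (r := (2⁻¹ : ℝ)) (by norm_num) (by norm_num)
    have h3 := tendsto_pow_atTop_nhds_zero_of_lt_one (r := (2⁻¹ : ℝ)) (by norm_num) (by norm_num)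
    simpa [add_mul] using h2.add h3
  have h4 := ENNReal.tendsto_ofReal h1
  rw [ENNReal.ofReal_zero] at h4
  refine h4.congr fun j => ?_
  rw [ENNReal.ofReal_mul (by positivity), ENNReal.ofReal_pow (by norm_num),
    ENNReal.ofReal_inv_of_pos (by norm_num), ENNReal.ofReal_ofNat]
  congr 1
  rw [← ENNReal.ofReal_natCast]
  push_cast
  rfl

/-- The factor 4 bounds the sum over k of 2^(-|n-k|), and 2BD comes from the mass of a single layer.
-/
theorem IsKernelFamily.isMaximalKernel (hm : ∀ k, 2 ≤ m k) {B : ℕ} (hB : ∀ k, m k ≤ B)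
    (hD : D ≠ ∞) (hS : IsKernelFamily m S D) :
    IsMaximalKernel (haar2 m) (squareNbhd m) (familyKernel m S) (2 * (B * D) * 4) where
  measurable := hS.measurable_familyKernel
  periodic j h hh p := by
    refine Finset.sum_congr rfl fun k hk => Finset.sum_congr rfl fun q hq =>
      Finset.sum_congr rfl fun a _ => ?_
    have hk := Finset.mem_range.1 hk
    have hq := Finset.mem_range.1 hq
    have := hS.periodic q k a j (by omega) (by omega) h hh p
    by_cases hp : p ∈ S q k a j <;> simp [hp, this]
  mass j := by
    -- The cutoff j + 1 excludes nothing, since q ≤ k ≤ j.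
    have heq : familyKernel m S j = fun p =>
        ∑ k ∈ Finset.range (j + 1), kernelPart m S (j + 1) k j p := by
      ext p
      refine Finset.sum_congr rfl fun k hk => ?_
      have hk := Finset.mem_range.1 hk
      rw [kernelPart, Finset.filter_true_of_mem]
      intro q hq
      have hq := Finset.mem_range.1 hq
      omega
    rw [heq, lintegral_finsetSum _ fun k _ => hS.measurable_kernelPart _ k j]
    calc ∑ k ∈ Finset.range (j + 1), ∫⁻ p, kernelPart m S (j + 1) k j p ∂(haar2 m)
        ≤ ∑ k ∈ Finset.range (j + 1), 2 * (B * D) * 2⁻¹ ^ (max j k - min j k) := by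
          refine Finset.sum_le_sum fun k hk => ?_
          have hk := Finset.mem_range.1 hk
          refine (hS.lintegral_kernelPart_le hm hB (by omega)).trans ?_
          rw [show min (j + 1) k = k by omega, show max j k = j by omega,
            show min j k = k by omega]
          gcongr
          exact M_mul_inv_le hm (by omega)
      _ ≤ _ := by
          rw [← Finset.mul_sum]
          gcongr
          exact (ENNReal.sum_le_tsum _).trans (tsum_two_inv_pow_dist_le j)
  tail n := by
    calc ∫⁻ p in (squareNbhd m n : Set (G m × G m))ᶜ, (⨆ j ≥ n, familyKernel m S j p) ∂(haar2 m)
        ≤ ∫⁻ p in (squareNbhd m n : Set (G m × G m))ᶜ,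
            (∑' k, kernelPart m S n k (max n k) p) ∂(haar2 m) := by
          refine setLIntegral_mono' (measurableSet_squareNbhd n).compl fun p hp => ?_
          refine iSup₂_le fun j hj => (hS.familyKernel_le (by simpa using hp)).trans ?_
          refine le_trans (Finset.sum_le_sum fun k hk => ?_) (ENNReal.sum_le_tsum _)
          have hk := Finset.mem_range.1 hk
          -- Both k ≤ j and n ≤ j hold, so j ≥ max(n,k): a bound independent of j, removing the
          -- supremum.
          exact kernelPart_antitone hS n k p (by omega)
      _ ≤ ∫⁻ p, (∑' k, kernelPart m S n k (max n k) p) ∂(haar2 m) :=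
          setLIntegral_le_lintegral _ _
      _ = ∑' k, ∫⁻ p, kernelPart m S n k (max n k) p ∂(haar2 m) :=
          lintegral_tsum fun k => (hS.measurable_kernelPart _ _ _).aemeasurable
      _ ≤ ∑' k, 2 * (B * D) * 2⁻¹ ^ (max n k - min n k) := by
          refine ENNReal.tsum_le_tsum fun k => ?_
          refine (hS.lintegral_kernelPart_le hm hB (by omega)).trans ?_
          gcongr
          exact M_mul_inv_le hm (by omega)
      _ ≤ _ := by
          rw [ENNReal.tsum_mul_left]
          gcongr
          exact tsum_two_inv_pow_dist_le n
  concentrate n := by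
    -- With n fixed, each of the j + 1 layers has mass O(M_n / M_j), and M_j ≥ 2^j.
    have hle : ∀ j, ∫⁻ p in (squareNbhd m n : Set (G m × G m))ᶜ, familyKernel m S j p ∂(haar2 m) ≤
        2 * (B * D) * M m n * (((j + 1 : ℕ) : ℝ≥0∞) * 2⁻¹ ^ j) := by
      intro j
      calc ∫⁻ p in (squareNbhd m n : Set (G m × G m))ᶜ, familyKernel m S j p ∂(haar2 m)
          ≤ ∫⁻ p in (squareNbhd m n : Set (G m × G m))ᶜ,
              ∑ k ∈ Finset.range (j + 1), kernelPart m S n k j p ∂(haar2 m) :=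
            setLIntegral_mono' (measurableSet_squareNbhd n).compl fun p hp =>
              hS.familyKernel_le (by simpa using hp)
        _ ≤ ∫⁻ p, ∑ k ∈ Finset.range (j + 1), kernelPart m S n k j p ∂(haar2 m) :=
            setLIntegral_le_lintegral _ _
        _ = ∑ k ∈ Finset.range (j + 1), ∫⁻ p, kernelPart m S n k j p ∂(haar2 m) :=
            lintegral_finsetSum _ fun k _ => hS.measurable_kernelPart _ _ _
        _ ≤ ∑ k ∈ Finset.range (j + 1), 2 * (B * D) * (M m n * 2⁻¹ ^ j) := by
            refine Finset.sum_le_sum fun k hk => ?_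
            have hk := Finset.mem_range.1 hk
            refine (hS.lintegral_kernelPart_le hm hB (by omega)).trans ?_
            have h0 := M_mul_inv_le hm (Nat.zero_le j)
            simp only [M, Nat.cast_one, one_mul, Nat.sub_zero] at h0
            gcongr
            exact monotone_M hm (min_le_left _ _)
        _ = _ := by
            rw [Finset.sum_const, Finset.card_range, nsmul_eq_mul]
            ring
    refine tendsto_of_tendsto_of_tendsto_of_le_of_le tendsto_const_nhds ?_ (fun _ => zero_le) hle
    have := ENNReal.Tendsto.const_mul (a := 2 * (B * D) * M m n) tendsto_succ_mul_two_inv_pow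
      (Or.inr (ENNReal.mul_ne_top (ENNReal.mul_ne_top (by simp)
        (ENNReal.mul_ne_top (ENNReal.natCast_ne_top _) hD)) (ENNReal.natCast_ne_top _)))
    simpa using this

/-- Almost everywhere convergence for the kernel of a family of sets. -/
theorem IsKernelFamily.ae_tendsto_oscMean (hm : ∀ k, 2 ≤ m k) {B : ℕ} (hB : ∀ k, m k ≤ B)
    (hD0 : D ≠ 0) (hD : D ≠ ∞) (hS : IsKernelFamily m S D) {f : G m × G m → ℂ}
    (hf : Integrable f (haar2 m)) :
    ∀ᵐ z ∂(haar2 m), Tendsto (fun j => oscMean (haar2 m) (familyKernel m S) f j z) atTop (𝓝 0) := by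
  have hB0 : B ≠ 0 := by have := hm 0; have := hB 0; omega
  exact (hS.isMaximalKernel hm hB hD).ae_tendsto_oscMean antitone_squareNbhd
    measurableSet_squareNbhd haar2_squareNbhd_ne_zero
    (by simp [hB0, hD0]) (ENNReal.mul_ne_top (ENNReal.mul_ne_top (by simp)
        (ENNReal.mul_ne_top (ENNReal.natCast_ne_top _) hD)) (by simp))
    (fun U hU => exists_squareNbhd_subset hU) hf

end KernelFamily

/-! ### The antidiagonal and rectangular families. -/

section Families

variable {m : ℕ → ℕ}

/-- The pairs in `I_k × I_k(a e_q)` whose sum has vanishing coordinates strictly between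
`k` and `j`. -/
def antidiagSet (m : ℕ → ℕ) (q k a j : ℕ) : Set (G m × G m) :=
  (nbhd m k 0 ×ˢ nbhd m k (axis m q a)) ∩ {p | ∀ l ∈ Finset.Ioo k j, p.1 l + p.2 l = 0}

/-- The rectangle `I_j × I_k(a e_q)`. -/
def rectSet (m : ℕ → ℕ) (q k a j : ℕ) : Set (G m × G m) :=
  nbhd m j 0 ×ˢ nbhd m k (axis m q a)

lemma axis_apply_of_lt {q a i : ℕ} (h : i < q) : axis m q a i = 0 :=
  Pi.single_eq_of_ne h.ne _

lemma nbhd_antitone (x : G m) : Antitone fun n => nbhd m n x :=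
  fun _ _ hab _ hy i hi => hy i (hi.trans_le hab)

lemma add_mem_nbhd_iff {n j : ℕ} (hnj : n ≤ j) {h : G m} (hh : ∀ i < j, h i = 0) (c x : G m) :
    x + h ∈ nbhd m n c ↔ x ∈ nbhd m n c := by
  refine forall₂_congr fun i hi => ?_
  rw [Pi.add_apply, hh i (hi.trans_le hnj), add_zero]

variable [∀ k, NeZero (m k)]

lemma isKernelFamily_rectSet {B : ℕ} (hB : 1 ≤ B) : IsKernelFamily m (rectSet m) B where
  measurable q k a j := (measurableSet_nbhd _ _).prod (measurableSet_nbhd _ _)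
  antitone q k a i j hij := Set.prod_mono (nbhd_antitone 0 hij) le_rfl
  periodic q k a j hqk hkj h hh p := by
    rw [mem_squareNbhd] at hh
    exact and_congr (add_mem_nbhd_iff le_rfl (fun i hi => (hh i hi).1) _ _)
      (add_mem_nbhd_iff hkj (fun i hi => (hh i hi).2) _ _)
  subset q k a j hqk hkj p hp := mem_squareNbhd.2 fun i hi =>
    ⟨hp.1 i (by omega), (hp.2 i (by omega)).trans (axis_apply_of_lt hi)⟩
  measure_le q k a j hqk hkj := by
    rw [rectSet, haar2, Measure.prod_prod, haar_nbhd, haar_nbhd, mul_assoc, mul_comm (M m j : ℝ≥0∞)⁻¹]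
    -- The constant 1 would do here; B lets all families share one constant.
    exact le_mul_of_one_le_left' (by exact_mod_cast hB)

lemma measurableSet_antidiagSet (q k a j : ℕ) : MeasurableSet (antidiagSet m q k a j) := by
  refine ((measurableSet_nbhd _ _).prod (measurableSet_nbhd _ _)).inter ?_
  simp only [Set.ofPred_forall]
  refine Finset.measurableSet_biInter _ fun l _ => ?_
  have h1 : Measurable fun p : G m × G m => p.1 l + p.2 l :=
    ((measurable_pi_apply l).comp measurable_fst).add ((measurable_pi_apply l).comp measurable_snd)
  exact h1 (MeasurableSet.singleton 0)

lemma prod_erase_inv_le {B : ℕ} (hB : ∀ k, m k ≤ B) (k j : ℕ) :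
    ∏ i ∈ (Finset.range j).erase k, (m i : ℝ≥0∞)⁻¹ ≤ B * (M m j : ℝ≥0∞)⁻¹ := by
  have hB1 : (1 : ℝ≥0∞) ≤ B := by
    exact_mod_cast (Nat.one_le_iff_ne_zero.2 (NeZero.ne (m 0))).trans (hB 0)
  have hM : ∏ i ∈ Finset.range j, (m i : ℝ≥0∞)⁻¹ = (M m j : ℝ≥0∞)⁻¹ := by
    rw [← haar_nbhd j (0 : G m), nbhd_eq, haar_eqOn]
  rw [← hM]
  by_cases hk : k ∈ Finset.range j
  · rw [← Finset.mul_prod_erase _ _ hk, ← mul_assoc]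
    refine le_mul_of_one_le_left' ?_
    rw [← div_eq_mul_inv, ENNReal.le_div_iff_mul_le (by simp [NeZero.ne]) (by simp), one_mul]
    exact_mod_cast hB k
  · rw [Finset.erase_eq_of_notMem hk]
    exact le_mul_of_one_le_left' hB1

/-- For fixed t in I_k, the section in u prescribes every coordinate below j except the k-th. That
free coordinate costs a factor at most B, and t ranges over measure 1/M_k. -/
lemma haar2_antidiagSet_le {B : ℕ} (hB : ∀ k, m k ≤ B) (q k a j : ℕ) :
    haar2 m (antidiagSet m q k a j) ≤ B * (M m k : ℝ≥0∞)⁻¹ * (M m j : ℝ≥0∞)⁻¹ := by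
  rw [haar2, Measure.prod_apply (measurableSet_antidiagSet q k a j)]
  calc ∫⁻ t, haar m (Prod.mk t ⁻¹' antidiagSet m q k a j) ∂(haar m)
      ≤ ∫⁻ t, (nbhd m k 0).indicator (fun _ => (B : ℝ≥0∞) * (M m j : ℝ≥0∞)⁻¹) t ∂(haar m) := by
        refine lintegral_mono fun t => ?_
        by_cases ht : t ∈ nbhd m k 0
        · rw [Set.indicator_of_mem ht]
          refine le_trans (measure_mono ?_) ((haar_eqOn ((Finset.range j).erase k)
            -- Below k, u agrees with a e_q; strictly between k and j it is forced to be -t.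
            (fun i => if i < k then axis m q a i else -t i)).trans_le (prod_erase_inv_le hB k j))
          intro u hu i hi
          simp only [Finset.mem_erase, Finset.mem_range] at hi
          split_ifs with hik
          · exact hu.1.2 i hik
          · have := hu.2 i (Finset.mem_Ioo.2 ⟨by omega, hi.2⟩)
            exact eq_neg_of_add_eq_zero_right this
        · have : Prod.mk t ⁻¹' antidiagSet m q k a j = ∅ := by
            ext u
            simp only [Set.mem_preimage, Set.mem_empty_iff_false, iff_false]
            exact fun hu => ht hu.1.1
          simp [this]
    _ = _ := by
        rw [lintegral_indicator_const (measurableSet_nbhd _ _), haar_nbhd]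
        ring

lemma isKernelFamily_antidiagSet {B : ℕ} (hB : ∀ k, m k ≤ B) :
    IsKernelFamily m (antidiagSet m) B where
  measurable := measurableSet_antidiagSet
  antitone q k a i j hij := Set.inter_subset_inter_right _ fun p hp l hl =>
    hp l (Finset.Ioo_subset_Ioo_right hij hl)
  periodic q k a j hqk hkj h hh p := by
    rw [mem_squareNbhd] at hh
    refine and_congr (and_congr (add_mem_nbhd_iff hkj (fun i hi => (hh i hi).1) _ _)
      (add_mem_nbhd_iff hkj (fun i hi => (hh i hi).2) _ _)) (forall₂_congr fun l hl => ?_)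
    have hl := hh l (Finset.mem_Ioo.1 hl).2
    simp [hl.1, hl.2]
  subset q k a j hqk hkj p hp := mem_squareNbhd.2 fun i hi =>
    ⟨hp.1.1 i (by omega), (hp.1.2 i (by omega)).trans (axis_apply_of_lt hi)⟩
  measure_le q k a j _ _ := haar2_antidiagSet_le hB q k a j

/-- Every requirement is symmetric in the two factors; this handles the two sums of `W` with the
coordinates interchanged. -/
lemma IsKernelFamily.swap {S : ℕ → ℕ → ℕ → ℕ → Set (G m × G m)} {D : ℝ≥0∞}
    (hS : IsKernelFamily m S D) : IsKernelFamily m (fun q k a j => Prod.swap ⁻¹' S q k a j) D where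
  measurable q k a j := measurable_swap (hS.measurable q k a j)
  antitone q k a i j hij := Set.preimage_mono (hS.antitone q k a hij)
  periodic q k a j hqk hkj h hh p := by
    refine hS.periodic q k a j hqk hkj h.swap ?_ p.swap
    rw [mem_squareNbhd] at hh ⊢
    exact fun i hi => (hh i hi).symm
  subset q k a j hqk hkj p hp := mem_squareNbhd.2 fun i hi =>
    (mem_squareNbhd.1 (hS.subset q k a j hqk hkj hp) i hi).symm
  measure_le q k a j hqk hkj := by
    have hswap : (haar2 m).map Prod.swap = haar2 m := Measure.prod_swap
    rw [← Measure.map_apply measurable_swap (hS.measurable q k a j), hswap]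
    exact hS.measure_le q k a j hqk hkj

end Families

/-! ### Size and support of the product of character sums. -/

section Rademacher

variable {m : ℕ → ℕ}

lemma M_dvd_M {r s : ℕ} (h : r ≤ s) : M m r ∣ M m s := by
  rw [← prod_range_eq_M, ← prod_range_eq_M]
  exact Finset.prod_dvd_prod_of_subset _ _ _ (Finset.range_mono h)

lemma digit_M (hm : ∀ k, 2 ≤ m k) (l k : ℕ) : digit m (M m l) k = if k = l then 1 else 0 := by
  have hpos := M_pos (m := m) (fun k => by have := hm k; omega)
  unfold digit
  rcases lt_trichotomy k l with h | h | h
  · rw [if_neg h.ne]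
    obtain ⟨c, hc⟩ := M_dvd_M (m := m) (Nat.succ_le_of_lt h)
    rw [hc, Nat.succ_eq_add_one, M, show m k * M m k * c = M m k * (m k * c) by ring,
      Nat.mul_div_cancel_left _ (hpos k), Nat.mul_mod_right]
  · subst h
    rw [if_pos rfl, Nat.div_self (hpos k), Nat.mod_eq_of_lt (hm k)]
  · rw [if_neg h.ne']
    have hlt : M m l < M m k := by
      have h1 : M m (l + 1) ≤ M m k := monotone_M hm h
      have h2 : 2 * M m l ≤ M m (l + 1) := Nat.mul_le_mul_right _ (hm l)
      have := hpos l
      omega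
    rw [Nat.div_eq_of_lt hlt, Nat.zero_mod]

lemma psi_M (hm : ∀ k, 2 ≤ m k) (l : ℕ) (x : G m) : psi m (M m l) x = rademacher m l x := by
  unfold psi
  rw [finprod_eq_single _ l]
  · simp [digit_M hm]
  · intro k hk
    simp [digit_M hm, hk]

lemma rademacher_eq_pow (l : ℕ) (x : G m) :
    rademacher m l x = Complex.exp (2 * Real.pi * Complex.I / (m l : ℂ)) ^ (x l).val := by
  rw [rademacher, ← Complex.exp_nat_mul]
  congr 1
  ring

lemma norm_rademacher (l : ℕ) (x : G m) : ‖rademacher m l x‖ = 1 := by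
  have : 2 * Real.pi * Complex.I * ((x l).val : ℂ) / (m l : ℂ) =
      ((2 * Real.pi * (x l).val / m l : ℝ) : ℂ) * Complex.I := by
    push_cast
    ring
  rw [rademacher, this, Complex.norm_exp_ofReal_mul_I]

/-- A full geometric sum of an m_l-th root of unity different from 1. -/
lemma sum_rademacher_pow_eq_zero [∀ k, NeZero (m k)] {l : ℕ} {x : G m} (hx : x l ≠ 0) :
    ∑ s ∈ Finset.range (m l), rademacher m l x ^ s = 0 := by
  have hζ := Complex.isPrimitiveRoot_exp (m l) (NeZero.ne _)
  rw [rademacher_eq_pow]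
  generalize Complex.exp (2 * Real.pi * Complex.I / (m l : ℂ)) = ζ at hζ ⊢
  rw [geom_sum_eq, ← pow_mul, Nat.mul_comm, pow_mul, hζ.pow_eq_one]
  · simp
  · refine hζ.pow_ne_one_of_pos_of_lt ?_ (ZMod.val_lt _)
    simpa [ZMod.val_eq_zero] using hx

lemma norm_rProd_le (hm : ∀ k, 2 ≤ m k) (i n : ℕ) (x y : G m) :
    ‖rProd m i n x y‖ ≤ ((∏ l ∈ Finset.Icc i n, m l : ℕ) : ℝ) := by
  rw [rProd, norm_prod, Nat.cast_prod]
  refine Finset.prod_le_prod (fun _ _ => norm_nonneg _) fun l _ => ?_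
  refine (norm_sum_le _ _).trans ?_
  simp [psi_M hm, norm_rademacher]

lemma rProd_eq_zero [∀ k, NeZero (m k)] (hm : ∀ k, 2 ≤ m k) {i n l : ℕ}
    (hl : l ∈ Finset.Icc i n) {x y : G m} (hxy : x l + y l ≠ 0) : rProd m i n x y = 0 := by
  refine Finset.prod_eq_zero hl ?_
  simp_rw [psi_M hm]
  exact sum_rademacher_pow_eq_zero hxy

/-- The product has modulus at most M_j / M_{k+1}, and M_k ≤ M_{k+1}. This turns the weight M_q M_k²
/ M_j into M_q M_k. -/
lemma inv_mul_enorm_rProd_le [∀ k, NeZero (m k)] (hm : ∀ k, 2 ≤ m k) {k j : ℕ} (hkj : k < j)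
    (x y : G m) : (M m j : ℝ≥0∞)⁻¹ * (M m k : ℝ≥0∞) * ‖rProd m (k + 1) (j - 1) x y‖ₑ ≤ 1 := by
  have hpos := M_pos (m := m) (fun k => by have := hm k; omega)
  have h1 : ‖rProd m (k + 1) (j - 1) x y‖ₑ ≤
      ((∏ l ∈ Finset.Icc (k + 1) (j - 1), m l : ℕ) : ℝ≥0∞) := by
    rw [← ofReal_norm, ← ENNReal.ofReal_natCast]
    exact ENNReal.ofReal_le_ofReal (norm_rProd_le hm _ _ x y)
  have h2 : M m k * ∏ l ∈ Finset.Icc (k + 1) (j - 1), m l ≤ M m j := by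
    have h3 : Finset.Icc (k + 1) (j - 1) = Finset.Ico (k + 1) j := by
      ext l
      simp only [Finset.mem_Icc, Finset.mem_Ico]
      omega
    rw [h3, ← prod_range_eq_M j, ← Finset.prod_range_mul_prod_Ico _ (Nat.succ_le_of_lt hkj),
      prod_range_eq_M]
    exact Nat.mul_le_mul_right _ (monotone_M hm (Nat.le_succ k))
  rw [mul_assoc, mul_comm, ← div_eq_mul_inv]
  refine ENNReal.div_le_of_le_mul ?_
  rw [one_mul]
  calc (M m k : ℝ≥0∞) * ‖rProd m (k + 1) (j - 1) x y‖ₑ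
      ≤ (M m k : ℝ≥0∞) * ((∏ l ∈ Finset.Icc (k + 1) (j - 1), m l : ℕ) : ℝ≥0∞) := by gcongr
    _ ≤ (M m j : ℝ≥0∞) := by exact_mod_cast h2

end Rademacher

/-! ### Bounding the sums in `W` by oscillation means. -/

section Estimate

variable {m : ℕ → ℕ} [∀ k, NeZero (m k)] {S : ℕ → ℕ → ℕ → ℕ → Set (G m × G m)} {D : ℝ≥0∞}

lemma IsKernelFamily.oscMean_eq (hS : IsKernelFamily m S D) {f : G m × G m → ℂ}
    (hf : AEStronglyMeasurable f (haar2 m)) (j : ℕ) (z : G m × G m) :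
    oscMean (haar2 m) (familyKernel m S) f j z =
      ∑ q ∈ Finset.range (j + 1), ∑ k ∈ Finset.Icc q j, ∑ a ∈ Finset.Ico 1 (m q),
        (M m q : ℝ≥0∞) * (M m k : ℝ≥0∞) *
          ∫⁻ p in S q k a j, ‖f (z - p) - f z‖ₑ ∂(haar2 m) := by
  have hΔ : AEMeasurable (fun p => ‖f (z - p) - f z‖ₑ) (haar2 m) :=
    ((hf.comp_quasiMeasurePreserving (quasiMeasurePreserving_sub_left (haar2 m) z)).sub
      aestronglyMeasurable_const).enorm
  have hterm : ∀ q k a, AEMeasurable (fun p => (M m q : ℝ≥0∞) * (M m k : ℝ≥0∞) *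
      (S q k a j).indicator 1 p * ‖f (z - p) - f z‖ₑ) (haar2 m) := fun q k a =>
    ((measurable_one.indicator (hS.measurable q k a j)).const_mul _).aemeasurable.mul hΔ
  unfold oscMean familyKernel
  simp_rw [Finset.sum_mul]
  rw [lintegral_finsetSum' _ fun k _ => Finset.aemeasurable_fun_sum _ fun q _ =>
    Finset.aemeasurable_fun_sum _ fun a _ => hterm q k a]
  rw [Finset.sum_comm' (t' := Finset.range (j + 1)) (s' := fun k => Finset.range (k + 1))
    (by intro q k; simp only [Finset.mem_range, Finset.mem_Icc]; omega)]
  refine Finset.sum_congr rfl fun k _ => ?_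
  rw [lintegral_finsetSum' _ fun q _ => Finset.aemeasurable_fun_sum _ fun a _ => hterm q k a]
  refine Finset.sum_congr rfl fun q _ => ?_
  rw [lintegral_finsetSum' _ fun a _ => hterm q k a]
  refine Finset.sum_congr rfl fun a _ => ?_
  simp_rw [mul_assoc]
  rw [lintegral_const_mul' _ _ (ENNReal.natCast_ne_top _),
    lintegral_const_mul' _ _ (ENNReal.natCast_ne_top _),
    ← lintegral_indicator (hS.measurable q k a j)]
  congr 2
  refine lintegral_congr fun p => ?_
  by_cases hp : p ∈ S q k a j <;> simp [hp]

lemma enorm_natCast_complex (n : ℕ) : ‖(n : ℂ)‖ₑ = n := by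
  rw [← ofReal_norm, Complex.norm_natCast, ENNReal.ofReal_natCast]

lemma IsKernelFamily.enorm_rectSum_le (hS : IsKernelFamily m S D) {f : G m × G m → ℂ}
    (hf : AEStronglyMeasurable f (haar2 m)) (j : ℕ) (z : G m × G m) :
    ‖∑ q ∈ Finset.range (j + 1), ∑ k ∈ Finset.Icc q j, (M m q : ℂ) * (M m k : ℂ) *
      ∑ a ∈ Finset.Ico 1 (m q), ∫ p in S q k a j, (‖f (z - p) - f z‖ : ℂ) ∂(haar2 m)‖ₑ ≤
      oscMean (haar2 m) (familyKernel m S) f j z := by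
  rw [hS.oscMean_eq hf]
  refine (enorm_sum_le _ _).trans (Finset.sum_le_sum fun q _ => ?_)
  refine (enorm_sum_le _ _).trans (Finset.sum_le_sum fun k _ => ?_)
  rw [enorm_mul, enorm_mul, enorm_natCast_complex, enorm_natCast_complex, ← Finset.mul_sum]
  gcongr
  refine (enorm_sum_le _ _).trans (Finset.sum_le_sum fun a _ => ?_)
  refine (enorm_integral_le_lintegral_enorm _).trans_eq (lintegral_congr fun p => ?_)
  rw [← ofReal_norm, Complex.norm_real, norm_norm, ofReal_norm]

/-- `rProd` is supported where the antidiagonal condition holds, so the integral over R reduces to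
S, and there its size is absorbed by M_k / M_j. -/
lemma IsKernelFamily.enorm_productSum_le (hm : ∀ k, 2 ≤ m k) (hS : IsKernelFamily m S D)
    {R : ℕ → ℕ → ℕ → Set (G m × G m)} (hR : ∀ q k a, MeasurableSet (R q k a))
    (hRS : ∀ q k a j, ∀ p ∈ R q k a, (∀ l ∈ Finset.Ioo k j, p.1 l + p.2 l = 0) → p ∈ S q k a j)
    {f : G m × G m → ℂ} (hf : AEStronglyMeasurable f (haar2 m)) (j : ℕ) (z : G m × G m) :
    ‖(M m j : ℂ)⁻¹ * ∑ q ∈ Finset.range j, ∑ k ∈ Finset.Ico q j, ∑ a ∈ Finset.Ico 1 (m q),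
      (M m q : ℂ) * (M m k : ℂ) ^ 2 * ∫ p in R q k a,
        (‖f (z - p) - f z‖ : ℂ) * rProd m (k + 1) (j - 1) p.1 p.2 ∂(haar2 m)‖ₑ ≤
      oscMean (haar2 m) (familyKernel m S) f j z := by
  have hpos := M_pos (m := m) (fun k => by have := hm k; omega)
  have hMj : (M m j : ℂ) ≠ 0 := Nat.cast_ne_zero.2 (hpos j).ne'
  have hMj' : (M m j : ℝ≥0∞)⁻¹ ≠ ∞ := by simpa using (hpos j).ne'
  have hterm : ∀ q k a, k < j → (M m j : ℝ≥0∞)⁻¹ * ‖(M m q : ℂ) * (M m k : ℂ) ^ 2 *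
      ∫ p in R q k a, (‖f (z - p) - f z‖ : ℂ) * rProd m (k + 1) (j - 1) p.1 p.2 ∂(haar2 m)‖ₑ ≤
      (M m q : ℝ≥0∞) * (M m k : ℝ≥0∞) *
        ∫⁻ p in S q k a j, ‖f (z - p) - f z‖ₑ ∂(haar2 m) := by
    intro q k a hkj
    rw [enorm_mul, enorm_mul, enorm_pow, enorm_natCast_complex, enorm_natCast_complex]
    calc (M m j : ℝ≥0∞)⁻¹ * ((M m q : ℝ≥0∞) * (M m k : ℝ≥0∞) ^ 2 * ‖∫ p in R q k a,
          (‖f (z - p) - f z‖ : ℂ) * rProd m (k + 1) (j - 1) p.1 p.2 ∂(haar2 m)‖ₑ)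
        = (M m q : ℝ≥0∞) * (M m k : ℝ≥0∞) * ((M m j : ℝ≥0∞)⁻¹ * (M m k : ℝ≥0∞) *
          ‖∫ p in R q k a, (‖f (z - p) - f z‖ : ℂ) *
            rProd m (k + 1) (j - 1) p.1 p.2 ∂(haar2 m)‖ₑ) := by ring
      _ ≤ (M m q : ℝ≥0∞) * (M m k : ℝ≥0∞) * ((M m j : ℝ≥0∞)⁻¹ * (M m k : ℝ≥0∞) *
          ∫⁻ p in R q k a, ‖f (z - p) - f z‖ₑ *
            ‖rProd m (k + 1) (j - 1) p.1 p.2‖ₑ ∂(haar2 m)) := by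
          gcongr
          refine (enorm_integral_le_lintegral_enorm _).trans_eq (lintegral_congr fun p => ?_)
          rw [enorm_mul]
          congr 1
          rw [← ofReal_norm, Complex.norm_real, norm_norm, ofReal_norm]
      _ ≤ _ := by
          gcongr
          rw [← lintegral_const_mul' _ _ (ENNReal.mul_ne_top hMj' (ENNReal.natCast_ne_top _)),
            ← lintegral_indicator (hS.measurable q k a j)]
          refine (setLIntegral_mono' (hR q k a) fun p hp => ?_).trans
            (setLIntegral_le_lintegral _ _)
          by_cases hpS : ∀ l ∈ Finset.Ioo k j, p.1 l + p.2 l = 0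
          · rw [Set.indicator_of_mem (hRS q k a j p hp hpS)]
            calc (M m j : ℝ≥0∞)⁻¹ * (M m k : ℝ≥0∞) * (‖f (z - p) - f z‖ₑ *
                  ‖rProd m (k + 1) (j - 1) p.1 p.2‖ₑ)
                = ((M m j : ℝ≥0∞)⁻¹ * (M m k : ℝ≥0∞) *
                  ‖rProd m (k + 1) (j - 1) p.1 p.2‖ₑ) * ‖f (z - p) - f z‖ₑ := by ring
              _ ≤ 1 * ‖f (z - p) - f z‖ₑ := by
                  gcongr
                  exact inv_mul_enorm_rProd_le hm hkj _ _
              _ = _ := one_mul _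
          · push Not at hpS
            obtain ⟨l, hl, hne⟩ := hpS
            have hl' := Finset.mem_Ioo.1 hl
            rw [rProd_eq_zero hm (Finset.mem_Icc.2 ⟨by omega, by omega⟩) hne]
            simp
  rw [hS.oscMean_eq hf, enorm_mul, enorm_inv hMj, enorm_natCast_complex]
  calc (M m j : ℝ≥0∞)⁻¹ * ‖∑ q ∈ Finset.range j, ∑ k ∈ Finset.Ico q j,
        ∑ a ∈ Finset.Ico 1 (m q), (M m q : ℂ) * (M m k : ℂ) ^ 2 * ∫ p in R q k a,
          (‖f (z - p) - f z‖ : ℂ) * rProd m (k + 1) (j - 1) p.1 p.2 ∂(haar2 m)‖ₑ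
      ≤ (M m j : ℝ≥0∞)⁻¹ * ∑ q ∈ Finset.range j, ∑ k ∈ Finset.Ico q j,
        ∑ a ∈ Finset.Ico 1 (m q), ‖(M m q : ℂ) * (M m k : ℂ) ^ 2 * ∫ p in R q k a,
          (‖f (z - p) - f z‖ : ℂ) * rProd m (k + 1) (j - 1) p.1 p.2 ∂(haar2 m)‖ₑ := by
        gcongr
        refine (enorm_sum_le _ _).trans (Finset.sum_le_sum fun q _ => ?_)
        refine (enorm_sum_le _ _).trans (Finset.sum_le_sum fun k _ => ?_)
        exact enorm_sum_le _ _
    _ ≤ ∑ q ∈ Finset.range j, ∑ k ∈ Finset.Ico q j, ∑ a ∈ Finset.Ico 1 (m q),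
        (M m q : ℝ≥0∞) * (M m k : ℝ≥0∞) *
          ∫⁻ p in S q k a j, ‖f (z - p) - f z‖ₑ ∂(haar2 m) := by
        simp_rw [Finset.mul_sum]
        exact Finset.sum_le_sum fun q _ => Finset.sum_le_sum fun k hk => Finset.sum_le_sum
          fun a _ => hterm q k a (Finset.mem_Ico.1 hk).2
    _ ≤ _ := by
        -- The kernel also includes the indices q = j and k = j; these extra terms are nonnegative.
        refine (Finset.sum_le_sum_of_subset (Finset.range_mono (Nat.le_succ j))).trans
          (Finset.sum_le_sum fun q _ => Finset.sum_le_sum_of_subset ?_)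
        exact Finset.Ico_subset_Icc_self

end Estimate

end Vilenkin

end

/-! ### Combining the four estimates. -/

theorem corollary1 (m : ℕ → ℕ) (hm : ∀ k, 2 ≤ m k) (hbdd : BddAbove (Set.range m))
    (f : Vilenkin.G m × Vilenkin.G m → ℂ) (hf : Integrable f (Vilenkin.haar2 m)) :
    (∀ᵐ z ∂(Vilenkin.haar2 m),
        Tendsto (fun n : ℕ => Vilenkin.W m n z.1 z.2 f) atTop (𝓝 0)) ∧
      (∀ᵐ z ∂(Vilenkin.haar2 m), Vilenkin.IsMarcinkiewiczLebesguePoint m f z) := by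
  suffices h : ∀ᵐ z ∂(Vilenkin.haar2 m),
      Tendsto (fun n : ℕ => Vilenkin.W m n z.1 z.2 f) atTop (𝓝 0) from ⟨h, h⟩
  have : ∀ k, NeZero (m k) := fun k => ⟨by have := hm k; omega⟩
  obtain ⟨B, hB'⟩ := hbdd
  have hB : ∀ k, m k ≤ B := fun k => hB' ⟨k, rfl⟩
  have hB1 : 1 ≤ B := by have := hm 0; have := hB 0; omega
  have hB0 : (B : ℝ≥0∞) ≠ 0 := by
    rw [Nat.cast_ne_zero]
    omega
  have hBt : (B : ℝ≥0∞) ≠ ∞ := ENNReal.natCast_ne_top _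
  have hA := Vilenkin.isKernelFamily_antidiagSet hB
  have hR := Vilenkin.isKernelFamily_rectSet (m := m) hB1
  have hn := fun n c => Vilenkin.measurableSet_nbhd (m := m) n c
  -- One family per sum of `W`: antidiagonal, its swap, rectangular, its swap.
  filter_upwards [hA.ae_tendsto_oscMean hm hB hB0 hBt hf,
    hA.swap.ae_tendsto_oscMean hm hB hB0 hBt hf, hR.ae_tendsto_oscMean hm hB hB0 hBt hf,
    hR.swap.ae_tendsto_oscMean hm hB hB0 hBt hf] with z h1 h2 h3 h4
  rw [tendsto_zero_iff_enorm_tendsto_zero]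
  have hsum := ((h1.add h2).add h3).add h4
  simp only [add_zero] at hsum
  refine tendsto_of_tendsto_of_tendsto_of_le_of_le tendsto_const_nhds hsum (fun _ => zero_le)
    fun j => ?_
  unfold Vilenkin.W
  refine (enorm_add_le _ _).trans (add_le_add ((enorm_add_le _ _).trans (add_le_add
    ((enorm_add_le _ _).trans (add_le_add ?_ ?_)) ?_)) ?_)
  · exact hA.enorm_productSum_le hm (fun q k a => (hn k _).prod (hn k _))
      (fun q k a j p hp h => ⟨hp, h⟩) hf.1 j z
  · exact hA.swap.enorm_productSum_le hm (fun q k a => (hn k _).prod (hn k _))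
      (fun q k a j p hp h => ⟨⟨hp.2, hp.1⟩, fun l hl => (add_comm _ _).trans (h l hl)⟩) hf.1 j z
  · exact hR.enorm_rectSum_le hf.1 j z
  · have hset : ∀ s i a : ℕ, Vilenkin.nbhd m i (Vilenkin.axis m s a) ×ˢ Vilenkin.nbhd m j 0 =
        Prod.swap ⁻¹' Vilenkin.rectSet m s i a j := by
      intro s i a
      rw [Vilenkin.rectSet, Set.preimage_swap_prod]
    simp_rw [hset]
    exact hR.swap.enorm_rectSum_le hf.1 j z
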